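/- Let $V$ be a complex vector space of finite dimension $2n$ with a symplectic form $\omega$ (bilinear, skew-symmetric, nondegenerate). Let $\phi: V\to V^*$, $\phi(v)=\omega(v,\cdot)$, be the induced isomorphism, and let $\omega'(\alpha,\beta)=\omega(\phi^{-1}\alpha,\phi^{-1}\beta)$ be the induced form on $V^*$. On the ring $\mathcal S=\mathbb C[V]$ of polynomial functions on $V$ consider the Poisson bracket $[f,g](x)=\omega'(\mathrm d f_x,\mathrm d g_x)$. Let $X\subset\mathbb P(V)$ be a projective subvariety, i.e. a Zariski closed subset, not necessarily irreducible. Let $\hat X\subset V$ be the affine cone over $X$, and let $\mathcal I=\mathcal I(X)\subset\mathcal S$ be the ideal of all polynomials that vanish at every $v\in V\setminus\{0\}$ with $[v]\in X$ (so $\mathcal I(\emptyset)=\mathcal S$). Call $X$ legendrian if for every smooth point $x\neq 0$ of $\hat X$ the tangent space $T_x\hat X\subset V$ is a Lagrangian subspace, i.e. maximal among the subspaces $W \subset V$ with $\omega|_W\equiv 0$. Then the following conditions are equivalent: (i) $X$ is legendrian; (ii) $\mathcal I$ is a Lie subalgebra of $\mathcal S$, i.e. $[f,g]\in\mathcal I$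 for all $f,g\in\mathcal I$, and every irreducible component of $X$ has dimension $n-1$. -/

import Mathlib

open scoped LinearAlgebra.Projectivization

namespace Legendre

section Geometry

variable {ι V : Type*} [Fintype ι] [AddCommGroup V] [Module ℂ V]

/-- The set of points of `ℙ(V)` at which all the homogeneous polynomials of `S` vanish. Polynomial
functions on `V` are written in the linear coordinates given by the basis `b`. -/
def projZeroLocus (b : Module.Basis ι ℂ V) (S : Set (MvPolynomial ι ℂ)) : Set (ℙ ℂ V) :=
  {p | ∀ f ∈ S, MvPolynomial.eval (b.equivFun p.rep) f = 0}

/-- The Zariski topology on `ℙ(V)`: the closed sets are the zero loci of sets of homogeneous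
polynomials. -/
@[reducible] def zariskiTopology (b : Module.Basis ι ℂ V) : TopologicalSpace (ℙ ℂ V) :=
  TopologicalSpace.ofClosed
    {Z | ∃ S : Set (MvPolynomial ι ℂ), (∀ f ∈ S, ∃ d, f.IsHomogeneous d) ∧ Z = projZeroLocus b S}
    ⟨{1}, by
      rintro f rfl
      exact ⟨0, MvPolynomial.isHomogeneous_one ι ℂ⟩, by
      ext p
      simp [projZeroLocus]⟩
    (by
      intro A hA
      refine ⟨{f | (∃ d, f.IsHomogeneous d) ∧ ∃ Z ∈ A, ∀ p ∈ Z,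
        MvPolynomial.eval (b.equivFun p.rep) f = 0}, fun f hf => hf.1, ?_⟩
      ext p
      constructor
      · rintro hp f ⟨-, Z, hZ, hf⟩
        exact hf p (hp Z hZ)
      · intro hp Z hZ
        obtain ⟨S, hS, rfl⟩ := hA hZ
        exact fun f hf => hp f ⟨hS f hf, _, hZ, fun q hq => hq f hf⟩)
    (by
      rintro Z ⟨S, hS, rfl⟩ W ⟨T, hT, rfl⟩
      refine ⟨{h | ∃ f ∈ S, ∃ g ∈ T, h = f * g}, ?_, ?_⟩
      · rintro h ⟨f, hf, g, hg, rfl⟩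
        obtain ⟨d, hd⟩ := hS f hf
        obtain ⟨e, he⟩ := hT g hg
        exact ⟨d + e, hd.mul he⟩
      · ext p
        constructor
        · rintro (hp | hp) h ⟨f, hf, g, hg, rfl⟩
          · rw [map_mul, hp f hf, zero_mul]
          · rw [map_mul, hp g hg, mul_zero]
        · intro hp
          by_contra hcon
          simp only [Set.mem_union, not_or, projZeroLocus, Set.mem_ofPred_eq, not_forall] at hcon
          obtain ⟨⟨f, hf, hf0⟩, g, hg, hg0⟩ := hcon
          have := hp (f * g) ⟨f, hf, g, hg, rfl⟩
          rw [map_mul] at this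
          exact (mul_ne_zero hf0 hg0) this)

/-- `X` is a projective subvariety of `ℙ(V)`, possibly reducible: a Zariski closed subset. -/
def IsProjectiveVariety (b : Module.Basis ι ℂ V) (X : Set (ℙ ℂ V)) : Prop :=
  @IsClosed _ (zariskiTopology b) X

/-- `Z` is an irreducible component of `X`: a maximal irreducible subset of `X`
(such a `Z` is automatically closed in `X`). -/
def IsIrreducibleComponent (b : Module.Basis ι ℂ V) (X Z : Set (ℙ ℂ V)) : Prop :=
  Maximal (fun W => W ⊆ X ∧ @IsIrreducible _ (zariskiTopology b) W) Z

/-- The dimension of a subset of `ℙ(V)`: the Krull dimension of the induced Zariski topology. -/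
noncomputable def projDim (b : Module.Basis ι ℂ V) (Z : Set (ℙ ℂ V)) : WithBot ℕ∞ :=
  letI := zariskiTopology b
  topologicalKrullDim Z

/-- The affine cone over `X` without its vertex `0`. -/
def puncturedCone (X : Set (ℙ ℂ V)) : Set V :=
  {v | ∃ hv : v ≠ 0, Projectivization.mk ℂ v hv ∈ X}

/-- The ideal `I(X)` of all polynomials on `V` that vanish on the punctured affine cone over `X`.
For `X ≠ ∅` these are the polynomials vanishing on the affine cone, and `I(∅)` is the unit
ideal. -/
noncomputable def idealOf (b : Module.Basis ι ℂ V) (X : Set (ℙ ℂ V)) :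
    Ideal (MvPolynomial ι ℂ) :=
  MvPolynomial.vanishingIdeal ℂ (b.equivFun '' puncturedCone X)

/-- The differential `df_x ∈ V*` of the polynomial function `f` at the point `x ∈ V`. -/
noncomputable def differential (b : Module.Basis ι ℂ V) (f : MvPolynomial ι ℂ) (x : V) :
    Module.Dual ℂ V :=
  ∑ i, MvPolynomial.eval (b.equivFun x) (MvPolynomial.pderiv i f) • b.coord i

/-- The tangent space at `x` to the affine cone over `X`, as a subspace of `V`. -/
noncomputable def tangentSpace (b : Module.Basis ι ℂ V) (X : Set (ℙ ℂ V)) (x : V) :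
    Submodule ℂ V where
  carrier := {v | ∀ f ∈ idealOf b X, differential b f x v = 0}
  add_mem' := by
    intro v w hv hw f hf
    rw [map_add, hv f hf, hw f hf, add_zero]
  zero_mem' := fun f _ => map_zero _
  smul_mem' := by
    intro c v hv f hf
    rw [map_smul, hv f hf, smul_zero]

/-- The dimension at `x` of the affine cone over `X`: the dimension of its local ring at `x`, that
is, the height of the maximal ideal of `x` in the coordinate ring of the cone. -/
noncomputable def coneDimAt (b : Module.Basis ι ℂ V) (X : Set (ℙ ℂ V)) (x : V) : ℕ∞ :=
  ((MvPolynomial.vanishingIdeal ℂ {b.equivFun x}).map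
    (Ideal.Quotient.mk (idealOf b X))).height

/-- The smooth points, other than `0`, of the affine cone over `X`: the points at which the
dimension of the tangent space equals the local dimension. -/
def smoothCone (b : Module.Basis ι ℂ V) (X : Set (ℙ ℂ V)) : Set V :=
  {x ∈ puncturedCone X | (Module.finrank ℂ (tangentSpace b X x) : ℕ∞) = coneDimAt b X x}

end Geometry

section Symplectic

variable {ι V : Type*} [Fintype ι] [AddCommGroup V] [Module ℂ V]

/-- A symplectic form: a bilinear form that is alternating and nondegenerate. -/
structure IsSymplectic (ω : LinearMap.BilinForm ℂ V) : Prop where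
  alt : ω.IsAlt
  nondegenerate : ω.Nondegenerate

/-- A Lagrangian subspace: maximal among the subspaces on which `ω` vanishes identically. -/
def IsLagrangian (ω : LinearMap.BilinForm ℂ V) (W : Submodule ℂ V) : Prop :=
  Maximal (fun U : Submodule ℂ V => ∀ u ∈ U, ∀ v ∈ U, ω u v = 0) W

/-- `X` is legendrian: the tangent space to the affine cone at each smooth point other than `0` is
Lagrangian. -/
def IsLegendrian (b : Module.Basis ι ℂ V) (ω : LinearMap.BilinForm ℂ V) (X : Set (ℙ ℂ V)) : Prop :=
  ∀ x ∈ smoothCone b X, IsLagrangian ω (tangentSpace b X x)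

/-- The form `ω'` on `V*`: the pullback of `ω` under the inverse of `φ : V ≃ V*`,
`φ v = ω v ·`. -/
noncomputable def dualForm [FiniteDimensional ℂ V] (ω : LinearMap.BilinForm ℂ V)
    (hω : IsSymplectic ω) (α β : Module.Dual ℂ V) : ℂ :=
  ω ((ω.toDual hω.nondegenerate).symm α) ((ω.toDual hω.nondegenerate).symm β)

/-- The Poisson bracket on polynomial functions on `V`, extending `ω'` to a biderivation. -/
noncomputable def poissonBracket [FiniteDimensional ℂ V] (b : Module.Basis ι ℂ V)
    (ω : LinearMap.BilinForm ℂ V) (hω : IsSymplectic ω) (f g : MvPolynomial ι ℂ) :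
    MvPolynomial ι ℂ :=
  ∑ i, ∑ j, MvPolynomial.C (dualForm ω hω (b.coord i) (b.coord j)) *
    (MvPolynomial.pderiv i f * MvPolynomial.pderiv j g)

/-- The defining property of the bracket: `[f, g](x) = ω'(df_x, dg_x)`. -/
theorem eval_poissonBracket [FiniteDimensional ℂ V] (b : Module.Basis ι ℂ V)
    (ω : LinearMap.BilinForm ℂ V) (hω : IsSymplectic ω) (f g : MvPolynomial ι ℂ) (x : V) :
    MvPolynomial.eval (b.equivFun x) (poissonBracket b ω hω f g) =
      dualForm ω hω (differential b f x) (differential b g x) := by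
  simp only [poissonBracket, dualForm, differential, map_sum, map_smul, map_mul,
    LinearMap.sum_apply, LinearMap.smul_apply, MvPolynomial.eval_C, smul_eq_mul, Finset.mul_sum]
  rw [Finset.sum_comm]
  refine Finset.sum_congr rfl fun i _ => Finset.sum_congr rfl fun j _ => ?_
  ring

end Symplectic

end Legendre

/-!
Write `I = I(X)` and `D = {df_x : f ∈ I} ⊆ V*`, so that the tangent space `T` to the cone at `x` is
the annihilator of `D`. Since `[f, g](x) = ω'(df_x, dg_x)`, the bracket of any two elements of `I`
vanishes at `x` exactly when `D` is isotropic for `ω'`, that is, when `T` contains its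
`ω`-orthogonal. A subspace with this property is Lagrangian as soon as its dimension is at most `n`.

If `X` is legendrian, then `[f, g]` vanishes at all smooth points of the cone. These are dense
(`mem_idealOf_of_forall_mem_smoothCone`), so `[f, g] ∈ I`; and every component of the cone contains
a smooth point whose tangent space has the dimension of that component
(`exists_mem_smoothCone_finrank_eq`), so every component of the cone has dimension `n`.
Conversely, if all components of the cone have dimension `n`, then `dim T = dim_x ≤ n` at a smooth
point `x` (`height_map_quotientMk_le`), while the closure of `I` under the bracket makes `T`
coisotropic (`orthogonal_tangentSpace_le`).

The algebraic geometry behind this is developed with the transcendence degree of the coordinate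
ring as the dimension.
* Primes of height one lower the dimension by exactly one
  (`affineDim_le_affineDim_quotient_add_one`): by Noether normalization one passes to a factorial
  ring, over which a height one prime lies over a principal prime. Hence
  heights in the coordinate ring of the cone, and lengths of chains of irreducible closed subsets
  of `ℙ(V)`, are computed by the transcendence degree (`affineDim_quotient_le_height`,
  `projDim_eq`).
* Generic smoothness (`exists_notMem_forall_mem_smoothCone`): the tangent space at a generic point
  of a component is at most as big as the component, because over a maximal independent set of
  coordinates each other coordinate satisfies a separable equation; and it is at least as big as
  the local dimension by Nakayama's lemma and Krull's height theorem.
* The irreducible components of `X` correspond to the minimal primes over `I`, which are homogeneous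
  (`idealOf_mem_minimalPrimes`, `isIrreducibleComponent_inter_projZeroLocus`).
-/

namespace Legendre

/-! ### Dimension of affine domains -/

section AffineDimension

variable (k : Type*) {A B : Type*} [Field k] [CommRing A] [CommRing B] [Algebra k A] [Algebra k B]

/-- The dimension of an affine algebra over a field, encoded as its transcendence degree. It is
meant for finitely generated domains, where the transcendence degree is a natural number. -/
noncomputable def affineDim (A : Type*) [CommRing A] [Algebra k A] : ℕ :=
  Cardinal.toNat (Algebra.trdeg k A)

theorem affineDim_mvPolynomial (s : ℕ) : affineDim k (MvPolynomial (Fin s) k) = s := by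
  simp [affineDim, MvPolynomial.trdeg_of_isDomain]

variable {k}

theorem affineDim_eq_of_isIntegral [IsDomain A] [Nontrivial B] [Algebra B A] [IsScalarTower k B A]
    [FaithfulSMul B A] [Algebra.IsIntegral B A] : affineDim k A = affineDim k B := by
  have : FaithfulSMul k B := (faithfulSMul_iff_algebraMap_injective k B).2
    (algebraMap k B).injective
  have h := lift_trdeg_add_eq k B A
  have h0 : Algebra.trdeg B A = 0 := trdeg_eq_zero
  have := congrArg Cardinal.toNat h
  rw [h0] at this
  simpa [affineDim] using this.symm

theorem affineDim_eq_of_algEquiv (e : A ≃ₐ[k] B) : affineDim k A = affineDim k B := by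
  have := congrArg Cardinal.toNat e.lift_trdeg_eq
  simpa [affineDim] using this

theorem card_le_affineDim_of_algebraicIndependent [Algebra.FiniteType k A] {τ : Type*} [Fintype τ]
    {x : τ → A} (hx : AlgebraicIndependent k x) : Fintype.card τ ≤ affineDim k A := by
  have h := hx.lift_cardinalMk_le_trdeg
  have := Cardinal.toNat_le_toNat h (by
    simpa using trdeg_lt_aleph0_of_finiteType)
  simpa [affineDim] using this

/-- A nonzero prime of a finitely generated domain cuts the dimension down. -/
theorem affineDim_quotient_lt [IsDomain A] [Algebra.FiniteType k A] (Q : Ideal A) [Q.IsPrime]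
    (hQ : Q ≠ ⊥) : affineDim k (A ⧸ Q) < affineDim k A := by
  have : FaithfulSMul k (A ⧸ Q) := (faithfulSMul_iff_algebraMap_injective k _).2
    (algebraMap k _).injective
  obtain ⟨s, hs⟩ := exists_isTranscendenceBasis k (A ⧸ Q)
  by_contra! hle
  let y : s → A := fun i => Function.surjInv Ideal.Quotient.mk_surjective i.1
  have hy : ⇑(Ideal.Quotient.mkₐ k Q) ∘ y = ((↑) : s → A ⧸ Q) :=
    funext fun i => Function.surjInv_eq _ _
  have hyi : AlgebraicIndependent k y :=
    AlgebraicIndependent.of_comp (Ideal.Quotient.mkₐ k Q) (by rw [hy]; exact hs.1)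
  have hfin : Algebra.trdeg k A < Cardinal.aleph0 := trdeg_lt_aleph0_of_finiteType
  have hfin' : Algebra.trdeg k (A ⧸ Q) < Cardinal.aleph0 := trdeg_lt_aleph0_of_finiteType
  -- a lift of a transcendence basis of the quotient would be a transcendence basis of `A`
  have hyb : IsTranscendenceBasis k y := by
    refine AlgebraicIndependent.isTranscendenceBasis_of_trdeg_le hyi hfin ?_
    rw [hs.cardinalMk_eq_trdeg]
    exact (Cardinal.toNat_le_iff_le_of_lt_aleph0 hfin hfin').1 hle
  have := hyb.isAlgebraic
  obtain ⟨q, hq, hq0⟩ := Submodule.exists_mem_ne_zero_of_ne_bot hQ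
  obtain ⟨r, hr, hr0⟩ := Submodule.exists_mem_ne_zero_of_ne_bot
    (Ideal.comap_ne_bot_of_algebraic_mem hq0 hq
      (Algebra.IsAlgebraic.isAlgebraic (R := Algebra.adjoin k (Set.range y)) q))
  obtain ⟨h, rfl⟩ := hyi.aevalEquiv.surjective r
  have h1 : MvPolynomial.aeval y h ∈ Q := by simpa using hr
  have h2 : MvPolynomial.aeval ((↑) : s → A ⧸ Q) h = 0 := by
    rw [← hy]
    have := MvPolynomial.comp_aeval_apply y (Ideal.Quotient.mkₐ k Q) h
    have h3 := Ideal.Quotient.eq_zero_iff_mem.2 h1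
    simpa [Function.comp_def] using this.symm.trans h3
  have h3 : h = 0 := (injective_iff_map_eq_zero _).1 hs.1 h h2
  exact hr0 (by simp [h3])

/-- A hypersurface in affine space has codimension at most one: the variables other than one
occurring in the equation stay independent. -/
theorem le_affineDim_quotient_span_singleton (s : ℕ) (p : MvPolynomial (Fin s) k) (hp : Prime p) :
    s ≤ affineDim k (MvPolynomial (Fin s) k ⧸ Ideal.span {p}) + 1 := by
  classical
  have hpr : (Ideal.span {p}).IsPrime := (Ideal.span_singleton_prime hp.ne_zero).2 hp
  obtain ⟨i, hi⟩ : ∃ i, p.degreeOf i ≠ 0 := by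
    by_contra! h
    have : p.totalDegree = 0 := by
      rw [MvPolynomial.totalDegree_eq_zero_iff]
      intro m hm i
      have := MvPolynomial.monomial_le_degreeOf i hm
      rw [h i] at this
      omega
    rw [MvPolynomial.totalDegree_eq_zero_iff_eq_C] at this
    rw [this] at hp
    refine hp.not_isUnit (IsUnit.map _ (Ne.isUnit fun h0 => hp.ne_zero ?_))
    rw [h0, map_zero]
  let x : {j // j ≠ i} → MvPolynomial (Fin s) k ⧸ Ideal.span {p} :=
    fun j => Ideal.Quotient.mk _ (MvPolynomial.X j.1)
  have hx : AlgebraicIndependent k x := by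
    refine (injective_iff_map_eq_zero _).2 fun h hh => ?_
    have h1 : MvPolynomial.rename (Subtype.val : {j // j ≠ i} → Fin s) h ∈ Ideal.span {p} := by
      rw [← Ideal.Quotient.eq_zero_iff_mem, ← hh]
      have := MvPolynomial.comp_aeval_apply (fun j : {j // j ≠ i} => MvPolynomial.X (R := k) j.1)
        (Ideal.Quotient.mkₐ k (Ideal.span {p})) h
      rw [MvPolynomial.rename_eq_aeval]
      simpa [Function.comp_def] using this
    obtain ⟨c, hc⟩ := Ideal.mem_span_singleton.1 h1
    by_contra h0
    have hne : MvPolynomial.rename (Subtype.val : {j // j ≠ i} → Fin s) h ≠ 0 := by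
      rwa [Ne, map_eq_zero_iff _ (MvPolynomial.rename_injective _ Subtype.val_injective)]
    have hd : (MvPolynomial.rename (Subtype.val : {j // j ≠ i} → Fin s) h).degreeOf i = 0 := by
      by_contra hv
      rw [← Ne, ← MvPolynomial.mem_vars_iff_degreeOf_ne_zero] at hv
      have := MvPolynomial.vars_rename _ _ hv
      obtain ⟨j, -, hj⟩ := Finset.mem_image.1 this
      exact j.2 hj
    rw [hc] at hne hd
    rw [MvPolynomial.degreeOf_mul_eq hp.ne_zero (right_ne_zero_of_mul hne)] at hd
    omega
  have := card_le_affineDim_of_algebraicIndependent hx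
  rw [Fintype.card_subtype_compl] at this
  simp at this
  omega

end AffineDimension

/-! ### Primes of height one in integral extensions of factorial domains -/

section HeightOne

/-- In the localization at a minimal prime `p` over `I`, the ideal `p` is the radical of `I`; this
is the same fact with denominators cleared. -/
theorem exists_notMem_mul_pow_mem_of_mem_minimalPrimes {R : Type*} [CommRing R] {I p : Ideal R}
    (hp : p ∈ I.minimalPrimes) {x : R} (hx : x ∈ p) : ∃ t ∉ p, ∃ n, t * x ^ n ∈ I := by
  have := hp.isPrime
  by_contra! h
  have hdis : Disjoint (I : Set R) (p.primeCompl ⊔ Submonoid.powers x : Submonoid R) := by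
    rw [Set.disjoint_left]
    rintro z hz hz'
    obtain ⟨t, ht, _, ⟨n, rfl⟩, rfl⟩ := Submonoid.mem_sup.1 hz'
    exact h t ht n hz
  obtain ⟨J, hJ, hIJ, hJd⟩ := Ideal.exists_le_prime_disjoint I _ hdis
  have hJp : J ≤ p := fun t ht => by
    by_contra htp
    exact Set.disjoint_left.1 hJd ht (Submonoid.mem_sup_left htp)
  exact Set.disjoint_left.1 hJd (hp.2 ⟨hJ, hIJ⟩ hJp hx)
    (Submonoid.mem_sup_right (Submonoid.mem_powers x))


variable {A B : Type*} [CommRing A] [CommRing B] [IsDomain A] [IsDomain B] [Algebra B A]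

open Polynomial in
/-- Scaling an integral element by `y` scales the roots of its minimal polynomial. Only the
minimality over the integrally closed base is used, so no fraction fields are needed. -/
theorem minpoly_algebraMap_mul [IsIntegrallyClosed B] [Module.IsTorsionFree B A] {s : A}
    (hs : IsIntegral B s) {y : B} (hy : y ≠ 0) :
    minpoly B (algebraMap B A y * s) = (minpoly B s).scaleRoots y := by
  refine (IsIntegrallyClosed.minpoly.unique ?_ ?_ fun Q hQ hQs => ?_).symm
  · exact (monic_scaleRoots_iff y).2 (minpoly.monic hs)
  · exact scaleRoots_aeval_eq_zero (minpoly.aeval B s)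
  · rw [degree_scaleRoots]
    have hd : (Q.comp (C y * X)).degree = Q.degree := by
      have hnz : ∀ n, (Q.comp (C y * X)).coeff n = 0 ↔ Q.coeff n = 0 := fun n => by
        rw [comp_C_mul_X_coeff, mul_eq_zero, or_iff_left (pow_ne_zero n hy)]
      have : (Q.comp (C y * X)).support = Q.support := by
        ext n
        simp only [mem_support_iff, ne_eq, hnz]
      simp only [degree, this]

    rw [← hd]
    refine minpoly.IsIntegrallyClosed.degree_le_of_ne_zero ?_ ?_
    · rw [← degree_ne_bot, hd, degree_ne_bot]
      exact hQ.ne_zero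
    · simpa [aeval_comp] using hQs

/-- A prime of height one in an integral extension of a factorial domain contracts to a principal
prime. If `p` is an irreducible element of the contraction, every `y` in the contraction satisfies
`s * y ^ n = p * a` with `s ∉ Q`; comparing the coefficients of the minimal polynomials of both
sides shows that `s` would be integral over the multiples of `p` unless `p ∣ y`. -/
theorem exists_prime_comap_eq_span [UniqueFactorizationMonoid B] [FaithfulSMul B A]
    [Algebra.IsIntegral B A] (Q : Ideal A) [Q.IsPrime] (hQ : Q ≠ ⊥)
    (hQ1 : Q.height ≤ 1) : ∃ p : B, Prime p ∧ Q.comap (algebraMap B A) = Ideal.span {p} := by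
  have hq : Q.comap (algebraMap B A) ≠ ⊥ := by
    obtain ⟨x, hx, hx0⟩ := Submodule.exists_mem_ne_zero_of_ne_bot hQ
    exact Ideal.comap_ne_bot_of_algebraic_mem hx0 hx (Algebra.IsIntegral.isIntegral x).isAlgebraic
  obtain ⟨p, hpq, hp⟩ := Ideal.IsPrime.exists_mem_prime_of_ne_bot
    (inferInstance : (Q.comap (algebraMap B A)).IsPrime) hq
  have hinj := FaithfulSMul.algebraMap_injective B A
  have hp0 : algebraMap B A p ≠ 0 := by
    rw [Ne, map_eq_zero_iff _ hinj]
    exact hp.ne_zero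
  -- As `Q` has height one, it is minimal over its nonzero element `p`.
  have hmin : Q ∈ (Ideal.span {algebraMap B A p}).minimalPrimes := by
    refine ⟨⟨‹_›, (Ideal.span_singleton_le_iff_mem _).2 hpq⟩, fun J hJ hJQ => ?_⟩
    obtain ⟨hJp, hJs⟩ := hJ
    by_contra hlt
    have h1 := Ideal.height_add_one_le_of_lt_of_isPrime (lt_of_le_not_ge hJQ hlt)
    have h2 : J.height + 1 ≤ 0 + 1 := (h1.trans hQ1).trans (by simp)
    have h3 : J.height = 0 := by
      have := (ENat.add_le_add_iff_right (by simp)).1 h2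
      simpa using this
    rw [Ideal.height_eq_zero_iff_eq_bot] at h3
    rw [h3] at hJs
    exact hp0 (by simpa using hJs)
  refine ⟨p, hp, le_antisymm (fun y hy => ?_) ((Ideal.span_singleton_le_iff_mem _).2 hpq)⟩
  rw [Ideal.mem_span_singleton]
  rcases eq_or_ne y 0 with rfl | hy0
  · exact dvd_zero p
  obtain ⟨s, hs, n, hsn⟩ := exists_notMem_mul_pow_mem_of_mem_minimalPrimes hmin hy
  obtain ⟨a, ha⟩ := Ideal.mem_span_singleton.1 hsn
  by_contra hpy
  have hpY : ¬ p ∣ y ^ n := fun h => hpy (hp.dvd_of_dvd_pow h)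
  have hs' : IsIntegral B s := Algebra.IsIntegral.isIntegral s
  -- Both sides are the minimal polynomial of `s * y ^ n = p * a`.
  have hE : (minpoly B s).scaleRoots (y ^ n) = (minpoly B a).scaleRoots p := by
    rw [← minpoly_algebraMap_mul hs' (pow_ne_zero n hy0),
      ← minpoly_algebraMap_mul (Algebra.IsIntegral.isIntegral a) hp.ne_zero, ← ha, map_pow,
      mul_comm]
  have hdeg : (minpoly B s).natDegree = (minpoly B a).natDegree := by
    have := congrArg Polynomial.natDegree hE
    simpa using this
  have hcoeff : ∀ i < (minpoly B s).natDegree, p ∣ (minpoly B s).coeff i := by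
    intro i hi
    have h := congrArg (fun f => Polynomial.coeff f i) hE
    simp only [Polynomial.coeff_scaleRoots] at h
    have hdvd : p ∣ (minpoly B s).coeff i * (y ^ n) ^ ((minpoly B s).natDegree - i) := by
      rw [h]
      exact Dvd.dvd.mul_left (dvd_pow_self p (by omega)) _
    exact (hp.dvd_or_dvd hdvd).resolve_right fun h' => hpY (hp.dvd_of_dvd_pow h')
  have h0 := minpoly.aeval B s
  rw [Polynomial.aeval_eq_sum_range, Finset.sum_range_succ, (minpoly.monic hs').coeff_natDegree,
    one_smul] at h0
  have hsum : ∑ i ∈ Finset.range (minpoly B s).natDegree, (minpoly B s).coeff i • s ^ i ∈ Q := by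
    refine Q.sum_mem fun i hi => ?_
    obtain ⟨c, hc⟩ := hcoeff i (Finset.mem_range.1 hi)
    rw [hc, Algebra.smul_def, map_mul, mul_assoc]
    exact Q.mul_mem_right _ hpq
  -- `s` is a root of a monic polynomial whose lower coefficients are multiples of `p ∈ Q`.
  have hpow : s ^ (minpoly B s).natDegree ∈ Q := by
    rw [← neg_eq_of_add_eq_zero_right h0]
    exact Q.neg_mem hsum
  exact hs (Ideal.IsPrime.mem_of_pow_mem ‹_› _ hpow)

end HeightOne

section Drop

variable {k : Type*} [Field k]

/-- A prime of height at most one in a finitely generated domain lowers the dimension by at most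
one. By Noether normalization the domain is integral over a polynomial ring, in which the prime
contracts to a hypersurface. -/
theorem affineDim_le_affineDim_quotient_add_one {A : Type*} [CommRing A] [IsDomain A] [Algebra k A]
    [Algebra.FiniteType k A] (Q : Ideal A) [Q.IsPrime] (hQ1 : Q.height ≤ 1) :
    affineDim k A ≤ affineDim k (A ⧸ Q) + 1 := by
  rcases eq_or_ne Q ⊥ with rfl | hQ
  · rw [affineDim_eq_of_algEquiv (AlgEquiv.quotientBot k A)]
    omega
  obtain ⟨s, g, hg, hgi⟩ := exists_integral_inj_algHom_of_fg k A
  algebraize [g.toRingHom]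
  have : FaithfulSMul (MvPolynomial (Fin s) k) A :=
    (faithfulSMul_iff_algebraMap_injective _ _).2 hg
  have : IsScalarTower k (MvPolynomial (Fin s) k) A := IsScalarTower.of_algebraMap_eq fun x =>
    (g.commutes x).symm
  have : Algebra.IsIntegral (MvPolynomial (Fin s) k) A := ⟨hgi⟩
  obtain ⟨p, hp, hpQ⟩ := exists_prime_comap_eq_span (B := MvPolynomial (Fin s) k) Q hQ hQ1
  have h1 := le_affineDim_quotient_span_singleton s p hp
  rw [affineDim_eq_of_isIntegral (k := k) (B := MvPolynomial (Fin s) k) (A := A),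
    affineDim_mvPolynomial]
  rw [← hpQ] at h1
  rwa [affineDim_eq_of_isIntegral (k := k) (A := A ⧸ Q)
    (B := MvPolynomial (Fin s) k ⧸ Q.comap (algebraMap (MvPolynomial (Fin s) k) A))]

end Drop

/-! ### Dimension and height -/

section Chains

variable {k R : Type*} [Field k] [CommRing R] [Algebra k R]

theorem map_quotientMk_isPrime {I Q : Ideal R} [Q.IsPrime] (h : I ≤ Q) :
    (Q.map (Ideal.Quotient.mk I)).IsPrime :=
  Ideal.map_isPrime_of_surjective Ideal.Quotient.mk_surjective (by rwa [Ideal.mk_ker])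

theorem comap_map_quotientMk {I Q : Ideal R} (h : I ≤ Q) :
    (Q.map (Ideal.Quotient.mk I)).comap (Ideal.Quotient.mk I) = Q := by
  rw [Ideal.comap_map_of_surjective' _ Ideal.Quotient.mk_surjective, Ideal.mk_ker, sup_eq_left.2 h]

theorem affineDim_quotient_map_quotientMk {P Q : Ideal R} (h : P ≤ Q) :
    affineDim k ((R ⧸ P) ⧸ Q.map (Ideal.Quotient.mk P)) = affineDim k (R ⧸ Q) :=
  affineDim_eq_of_algEquiv (DoubleQuot.quotQuotEquivQuotOfLEₐ k h)

variable [Algebra.FiniteType k R]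

variable (k) in
theorem affineDim_quotient_lt_of_lt {P Q : Ideal R} [P.IsPrime] [Q.IsPrime] (h : P < Q) :
    affineDim k (R ⧸ Q) < affineDim k (R ⧸ P) := by
  have := map_quotientMk_isPrime h.le
  rw [← affineDim_quotient_map_quotientMk h.le]
  refine affineDim_quotient_lt _ fun h0 => h.not_ge ?_
  have := comap_map_quotientMk h.le
  rw [h0, ← RingHom.ker_eq_comap_bot, Ideal.mk_ker] at this
  exact this.ge

variable (k) in
/-- Adding one equation lowers the dimension by exactly one: if `f` lies in a prime `M` but not in
the smaller prime `P`, then below `M` there is a component of `V(P) ∩ V(f)` of codimension one in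
`V(P)`. -/
theorem exists_minimalPrimes_affineDim_add_one {P M : Ideal R} [P.IsPrime] [M.IsPrime]
    (hPM : P ≤ M) {f : R} (hfM : f ∈ M) (hfP : f ∉ P) :
    ∃ Q ∈ (P ⊔ Ideal.span {f}).minimalPrimes, Q ≤ M ∧
      affineDim k (R ⧸ Q) + 1 = affineDim k (R ⧸ P) := by
  have : IsNoetherianRing R := Algebra.FiniteType.isNoetherianRing k R
  obtain ⟨Q, hQ, hQM⟩ := Ideal.exists_minimalPrimes_le
    (sup_le hPM ((Ideal.span_singleton_le_iff_mem _).2 hfM))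
  refine ⟨Q, hQ, hQM, le_antisymm ?_ ?_⟩
  · have := hQ.isPrime
    refine affineDim_quotient_lt_of_lt k (lt_of_le_of_ne (le_sup_left.trans hQ.1.2) ?_)
    rintro rfl
    exact hfP ((le_sup_right.trans hQ.1.2) (Ideal.mem_span_singleton_self f))
  · have := hQ.isPrime
    have hPQ : P ≤ Q := le_sup_left.trans hQ.1.2
    have := map_quotientMk_isPrime hPQ
    rw [← affineDim_quotient_map_quotientMk hPQ]
    exact affineDim_le_affineDim_quotient_add_one _
      (Ideal.map_height_le_one_of_mem_minimalPrimes hQ)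

variable (k) in
/-- In the quotient by `I`, a prime `M` of dimension zero has height at least the dimension of any
prime between `I` and `M`: cut down one equation at a time inside `M`. -/
theorem affineDim_quotient_le_height {I Q M : Ideal R} [hQ : Q.IsPrime] [M.IsPrime] (hIQ : I ≤ Q)
    (hQM : Q ≤ M) (hM : affineDim k (R ⧸ M) = 0) :
    (affineDim k (R ⧸ Q) : ℕ∞) ≤ (M.map (Ideal.Quotient.mk I)).height := by
  suffices h : ∀ d, ∀ Q : Ideal R, Q.IsPrime → I ≤ Q → Q ≤ M → affineDim k (R ⧸ Q) = d →
      (Q.map (Ideal.Quotient.mk I)).height + d ≤ (M.map (Ideal.Quotient.mk I)).height from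
    le_add_self.trans (h _ Q hQ hIQ hQM rfl)
  intro d
  induction d with
  | zero =>
    intro Q hQ hIQ hQM hd
    simpa using Ideal.height_mono (Ideal.map_mono hQM)
  | succ d ih =>
    intro Q hQ hIQ hQM hd
    obtain ⟨f, hfM, hfQ⟩ : ∃ f ∈ M, f ∉ Q := by
      by_contra! h
      rw [le_antisymm hQM h, hM] at hd
      omega
    obtain ⟨Q', hQ', hQM', hd'⟩ := exists_minimalPrimes_affineDim_add_one k hQM hfM hfQ
    have hp := hQ'.isPrime
    have hQQ' : Q ≤ Q' := le_sup_left.trans hQ'.1.2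
    have hfQ' : f ∈ Q' := (le_sup_right.trans hQ'.1.2) (Ideal.mem_span_singleton_self f)
    have h1 := ih Q' hp (hIQ.trans hQQ') hQM' (by omega)
    have := map_quotientMk_isPrime hIQ
    have := map_quotientMk_isPrime (hIQ.trans hQQ')
    have h2 : Q.map (Ideal.Quotient.mk I) < Q'.map (Ideal.Quotient.mk I) := by
      refine lt_of_le_of_ne (Ideal.map_mono hQQ') fun h => hfQ ?_
      rw [← comap_map_quotientMk hIQ, h, comap_map_quotientMk (hIQ.trans hQQ')]
      exact hfQ'
    refine le_trans ?_ h1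
    have h3 := Ideal.height_add_one_le_of_lt_of_isPrime h2
    push_cast
    rw [add_comm (d : ℕ∞) 1, ← add_assoc]
    gcongr

/-- The dimension is strictly decreasing along chains of primes, so it bounds heights in the
quotient by `I`. -/
theorem height_map_quotientMk_le {I M : Ideal R} [M.IsPrime] (hIM : I ≤ M) {n : ℕ}
    (hn : ∀ P ∈ I.minimalPrimes, affineDim k (R ⧸ P) ≤ n) :
    (M.map (Ideal.Quotient.mk I)).height ≤ n := by
  have := map_quotientMk_isPrime hIM
  have hle : ∀ J : Ideal R, J.IsPrime → I ≤ J → affineDim k (R ⧸ J) ≤ n := by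
    intro J hJ hIJ
    obtain ⟨P, hP, hPJ⟩ := Ideal.exists_minimalPrimes_le hIJ
    have := hP.isPrime
    rcases hPJ.eq_or_lt with rfl | h
    · exact hn _ hP
    · exact (affineDim_quotient_lt_of_lt k h).le.trans (hn P hP)
  have hIc (J : PrimeSpectrum (R ⧸ I)) : I ≤ J.asIdeal.comap (Ideal.Quotient.mk I) := by
    conv_lhs => rw [← Ideal.mk_ker (I := I)]
    exact Ideal.ker_le_comap _
  let φ : PrimeSpectrum (R ⧸ I) → ℕ := fun J =>
    n - affineDim k (R ⧸ J.asIdeal.comap (Ideal.Quotient.mk I))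
  have hφ : StrictMono φ := by
    intro J K hJK
    have hlt : J.asIdeal.comap (Ideal.Quotient.mk I) < K.asIdeal.comap (Ideal.Quotient.mk I) := by
      refine lt_of_le_of_ne (Ideal.comap_mono hJK.le) fun h => hJK.ne ?_
      exact PrimeSpectrum.ext (Ideal.comap_injective_of_surjective _ Ideal.Quotient.mk_surjective h)
    have h1 := affineDim_quotient_lt_of_lt k hlt
    have h2 := hle _ inferInstance (hIc J)
    simp only [φ]
    omega
  have h := Order.height_le_height_apply_of_strictMono φ hφ ⟨_, ‹_›⟩
  rw [← PrimeSpectrum.height_eq_orderHeight, Order.height_nat] at h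
  exact h.trans (by exact_mod_cast Nat.sub_le _ _)

end Chains

/-! ### Partial derivatives of polynomials -/

section PartialDerivatives

open MvPolynomial

variable {σ K : Type*} [Field K] {f : MvPolynomial σ K} {j : σ}

theorem add_single_mem_support_of_mem_support_pderiv {m : σ →₀ ℕ} (hm : m ∈ (pderiv j f).support) :
    m + Finsupp.single j 1 ∈ f.support := by
  rw [mem_support_iff, coeff_pderiv] at hm
  exact mem_support_iff.2 (left_ne_zero_of_mul hm)

theorem vars_pderiv_subset : (pderiv j f).vars ⊆ f.vars := by
  intro i hi
  obtain ⟨m, hm, him⟩ := (mem_vars_iff_mem_support _).1 hi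
  refine (mem_vars_iff_mem_support _).2
    ⟨_, add_single_mem_support_of_mem_support_pderiv hm, ?_⟩
  simp only [Finsupp.mem_support_iff, Finsupp.add_apply] at him ⊢
  omega

theorem totalDegree_pderiv_lt (h : pderiv j f ≠ 0) : (pderiv j f).totalDegree < f.totalDegree := by
  have key : ∀ m ∈ (pderiv j f).support, (m.sum fun _ e => e) < f.totalDegree := fun m hm => by
    have := le_totalDegree (add_single_mem_support_of_mem_support_pderiv hm)
    rw [Finsupp.sum_add_index' (fun _ => rfl) (fun _ _ _ => rfl), Finsupp.sum_single_index rfl]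
      at this
    omega
  obtain ⟨m, hm⟩ := support_nonempty.2 h
  exact (Finset.sup_lt_iff ((Nat.zero_le _).trans_lt (key m hm))).2 key

theorem notMem_vars_of_pderiv_eq_zero [CharZero K] (h : pderiv j f = 0) : j ∉ f.vars := by
  intro hj
  obtain ⟨m, hm, hjm⟩ := (mem_vars_iff_mem_support _).1 hj
  have h1 := congrArg (coeff (m - Finsupp.single j 1)) h
  rw [coeff_pderiv, coeff_zero, tsub_add_cancel_of_le] at h1
  · rcases mul_eq_zero.1 h1 with h2 | h2
    · exact mem_support_iff.1 hm h2
    · exact (Nat.cast_add_one_ne_zero _) h2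
  · rw [Finsupp.single_le_iff]
    exact Nat.one_le_iff_ne_zero.2 (Finsupp.mem_support_iff.1 hjm)

end PartialDerivatives

/-! ### Tangent spaces and local dimension -/

section GenericTangent

open MvPolynomial

variable {ι V : Type*} [Fintype ι] [AddCommGroup V] [Module ℂ V]

theorem differential_apply (b : Module.Basis ι ℂ V) (f : MvPolynomial ι ℂ) (x v : V) :
    differential b f x v = ∑ i, eval (b.equivFun x) (pderiv i f) * b.coord i v := by
  simp [differential]

/-- If no nonzero polynomial in the coordinates `s` lies in `P`, these coordinates are independent
modulo `P`. -/
theorem card_le_affineDim_of_supported {P : Ideal (MvPolynomial ι ℂ)} [P.IsPrime] {s : Finset ι}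
    (hs : ∀ f ∈ supported ℂ (s : Set ι), f ∈ P → f = 0) :
    s.card ≤ affineDim ℂ (MvPolynomial ι ℂ ⧸ P) := by
  have hx : AlgebraicIndependent ℂ
      (fun i : s => Ideal.Quotient.mk P (X i.1 : MvPolynomial ι ℂ)) := by
    refine (injective_iff_map_eq_zero _).2 fun h hh => ?_
    have h1 : rename (Subtype.val : s → ι) h ∈ P := by
      rw [← Ideal.Quotient.eq_zero_iff_mem, ← hh]
      have := comp_aeval_apply (fun j : s => X (R := ℂ) j.1) (Ideal.Quotient.mkₐ ℂ P) h
      rw [rename_eq_aeval]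
      simpa [Function.comp_def] using this
    have h2 := hs _ (by
      rw [supported_eq_range_rename]
      exact ⟨h, rfl⟩) h1
    exact (map_eq_zero_iff _ (rename_injective _ Subtype.val_injective)).1 h2
  simpa using card_le_affineDim_of_algebraicIndependent hx

/-- At a generic point of the variety of a prime `P` the Zariski tangent space is no bigger than
the dimension of the variety. Over a maximal independent set `s` of coordinates, every other
coordinate `x_j` satisfies an equation in `P`; one of minimal degree has `∂f/∂x_j ∉ P`, as the
characteristic is zero, so a tangent vector is determined by its coordinates in `s` wherever
these partial derivatives do not vanish. -/
theorem exists_finrank_tangent_le_affineDim (b : Module.Basis ι ℂ V)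
    (P : Ideal (MvPolynomial ι ℂ)) [hP : P.IsPrime] :
    ∃ h ∉ P, ∀ x : V, eval (b.equivFun x) h ≠ 0 → ∀ W : Submodule ℂ V,
      (∀ v ∈ W, ∀ f ∈ P, differential b f x v = 0) →
        Module.finrank ℂ W ≤ affineDim ℂ (MvPolynomial ι ℂ ⧸ P) := by
  classical
  -- A maximal set `s` of coordinates independent modulo `P`.
  obtain ⟨s, hs⟩ := (Set.toFinite {s : Finset ι |
    ∀ f ∈ supported ℂ (s : Set ι), f ∈ P → f = 0}).exists_maximal ⟨∅, by
      intro f hf hfP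
      rw [Finset.coe_empty, supported_empty, Algebra.mem_bot] at hf
      obtain ⟨c, rfl⟩ := hf
      by_contra h0
      refine hP.ne_top (Ideal.eq_top_of_isUnit_mem _ hfP (IsUnit.map _ (Ne.isUnit ?_)))
      rintro rfl
      exact h0 (map_zero _)⟩
  have hex : ∀ j ∉ s, ∃ f ∈ P, f ∈ supported ℂ (insert j s : Set ι) ∧ pderiv j f ∉ P := by
    intro j hj
    have hns : ∃ f, f ∈ supported ℂ (insert j s : Set ι) ∧ f ∈ P ∧ f ≠ 0 := by
      by_contra! hcon
      have := hs.2 (y := insert j s) (by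
        intro f hf hfP
        rw [Finset.coe_insert] at hf
        exact hcon f hf hfP) (Finset.subset_insert j s)
      exact hj (this (Finset.mem_insert_self j s))
    obtain ⟨f, ⟨hf, hfP, hf0⟩, hmin⟩ := exists_minimalFor_of_wellFoundedLT _ totalDegree hns
    refine ⟨f, hfP, hf, fun hd => ?_⟩
    by_cases h0 : pderiv j f = 0
    · refine hf0 (hs.1 f ?_ hfP)
      rw [mem_supported] at hf ⊢
      intro i hi
      refine (hf hi).resolve_left ?_
      rintro rfl
      exact notMem_vars_of_pderiv_eq_zero h0 hi
    · have hlt := totalDegree_pderiv_lt h0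
      have hsup : pderiv j f ∈ supported ℂ (insert j s : Set ι) := by
        rw [mem_supported] at hf ⊢
        exact (Finset.coe_subset.2 vars_pderiv_subset).trans hf
      exact hlt.not_ge (hmin ⟨hsup, hd, h0⟩ hlt.le)
  choose! F hFP hFs hFd using hex
  refine ⟨∏ j ∈ sᶜ, pderiv j (F j), fun hmem => ?_, fun x hx W hW => ?_⟩
  · obtain ⟨j, hj, hjP⟩ := (hP.prod_mem_iff).1 hmem
    exact hFd j (Finset.mem_compl.1 hj) hjP
  · rw [map_prod, Finset.prod_ne_zero_iff] at hx
    let φ : W →ₗ[ℂ] (s → ℂ) := LinearMap.pi fun i => (b.coord i.1).comp W.subtype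
    have hφ : Function.Injective φ := by
      refine (injective_iff_map_eq_zero φ).2 fun v hv => ?_
      have hvs : ∀ i ∈ s, b.coord i v.1 = 0 := fun i hi => congrFun hv ⟨i, hi⟩
      have hall : ∀ j, b.coord j v.1 = 0 := by
        intro j
        by_cases hj : j ∈ s
        · exact hvs j hj
        have h1 := hW v.1 v.2 (F j) (hFP j hj)
        rw [differential_apply, Finset.sum_eq_single j] at h1
        · exact (mul_eq_zero.1 h1).resolve_left (hx j (Finset.mem_compl.2 hj))
        · intro i _ hij
          by_cases hi : i ∈ s
          · rw [hvs i hi, mul_zero]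
          · rw [pderiv_eq_zero_of_notMem_vars, map_zero, zero_mul]
            intro hiv
            rcases (mem_supported.1 (hFs j hj)) hiv with h | h
            · exact hij h
            · exact hi h
        · simp
      have : v.1 = 0 := b.ext_elem fun i => by simpa using hall i
      exact Subtype.ext this
    calc Module.finrank ℂ W ≤ Module.finrank ℂ (s → ℂ) :=
          LinearMap.finrank_le_finrank_of_injective hφ
      _ = s.card := by simp
      _ ≤ _ := card_le_affineDim_of_supported hs.1

/-- The linear map sending a polynomial function to its differential at `x`. -/
noncomputable def differentialₗ (b : Module.Basis ι ℂ V) (x : V) :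
    MvPolynomial ι ℂ →ₗ[ℂ] Module.Dual ℂ V where
  toFun f := differential b f x
  map_add' f g := by simp [differential, add_smul, Finset.sum_add_distrib]
  map_smul' c f := by simp [differential, Finset.smul_sum, smul_smul]

theorem tangentSpace_eq_dualCoannihilator (b : Module.Basis ι ℂ V) (X : Set (ℙ ℂ V)) (x : V) :
    tangentSpace b X x = (((idealOf b X).restrictScalars ℂ).map
      (differentialₗ b x)).dualCoannihilator := by
  ext v
  rw [Submodule.mem_dualCoannihilator]
  constructor
  · rintro hv _ ⟨f, hf, rfl⟩
    exact hv f hf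
  · exact fun hv f hf => hv _ ⟨f, hf, rfl⟩

theorem mem_vanishingIdeal_singleton {σ : Type*} {y : σ → ℂ} {f : MvPolynomial σ ℂ} :
    f ∈ vanishingIdeal ℂ {y} ↔ eval y f = 0 := by
  simp [mem_vanishingIdeal_iff, aeval_eq_eval]

/-- Taylor expansion to first order at `y`: the remainder lies in the square of the maximal
ideal. -/
theorem sub_taylor_mem_sq (y : ι → ℂ) (f : MvPolynomial ι ℂ) :
    f - C (eval y f) - ∑ i, C (eval y (pderiv i f)) * (X i - C (y i)) ∈
      vanishingIdeal ℂ {y} ^ 2 := by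
  classical
  have hX : ∀ i, (X i - C (y i) : MvPolynomial ι ℂ) ∈ vanishingIdeal ℂ {y} := fun i => by
    simp
  have hL : ∀ f : MvPolynomial ι ℂ,
      ∑ i, C (eval y (pderiv i f)) * (X i - C (y i)) ∈ vanishingIdeal ℂ {y} := fun f =>
    Ideal.sum_mem _ fun i _ => Ideal.mul_mem_left _ _ (hX i)
  induction f using MvPolynomial.induction_on with
  | C a => simp
  | add p q hp hq =>
    convert Ideal.add_mem _ hp hq using 1
    simp only [map_add, add_mul, Finset.sum_add_distrib]
    ring
  | mul_X p j hp =>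
    have h1 := Ideal.mul_mem_right (X j) _ hp
    have h2 : (∑ i, C (eval y (pderiv i p)) * (X i - C (y i))) * (X j - C (y j)) ∈
        vanishingIdeal ℂ {y} ^ 2 := by
      rw [pow_two]
      exact Ideal.mul_mem_mul (hL p) (hX j)
    convert Ideal.add_mem _ h1 h2 using 1
    have h3 : ∑ i, C (eval y (pderiv i (p * X j))) * (X i - C (y i)) =
        (∑ i, C (eval y (pderiv i p)) * (X i - C (y i))) * C (y j) +
          C (eval y p) * (X j - C (y j)) := by
      simp only [pderiv_mul, map_add, map_mul, add_mul, Finset.sum_add_distrib, eval_X]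
      congr 1
      · rw [Finset.sum_mul]
        exact Finset.sum_congr rfl fun i _ => by ring
      · rw [Finset.sum_eq_single j]
        · simp
        · intro i _ hij
          simp [pderiv_X_of_ne hij.symm]
        · simp
    rw [h3]
    simp only [map_mul, eval_X]
    ring

/-- The Zariski tangent space is at least as big as the local dimension. Take linear forms
restricting to a basis of the cotangent space; by Nakayama's lemma the maximal ideal of the point
is minimal over the ideal they generate, and Krull's height theorem applies. -/
theorem coneDimAt_le_finrank_tangentSpace (b : Module.Basis ι ℂ V) (X : Set (ℙ ℂ V)) {x : V}
    (hx : x ∈ puncturedCone X) :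
    coneDimAt b X x ≤ Module.finrank ℂ (tangentSpace b X x) := by
  classical
  have := Module.Finite.of_basis b
  set y := b.equivFun x with hy
  set m := vanishingIdeal ℂ {y} with hm
  set I := idealOf b X with hI
  have hmax : m.IsMaximal := inferInstance
  have hIm : I ≤ m := vanishingIdeal_anti_mono (Set.singleton_subset_iff.2 ⟨x, hx, rfl⟩)
  set D := (I.restrictScalars ℂ).map (differentialₗ b x) with hD
  -- The cotangent space `V* / D` has the dimension of the tangent space.
  have hfr : Module.finrank ℂ (Module.Dual ℂ V ⧸ D) = Module.finrank ℂ (tangentSpace b X x) := by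
    have h1 := Subspace.finrank_add_finrank_dualCoannihilator_eq D
    have h2 := D.finrank_quotient_add_finrank
    rw [Subspace.dual_finrank_eq] at h2
    rw [tangentSpace_eq_dualCoannihilator, ← hI, ← hD]
    omega
  set t := Module.finrank ℂ (tangentSpace b X x)
  let e : Module.Basis (Fin t) ℂ (Module.Dual ℂ V ⧸ D) := Module.finBasisOfFinrankEq _ _ hfr
  choose α hα using fun k => D.mkQ_surjective (e k)
  -- `l k` is the affine linear polynomial vanishing at `x` with differential `α k`.
  let l : Fin t → MvPolynomial ι ℂ := fun k => ∑ i, C (α k (b i)) * (MvPolynomial.X i - C (y i))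
  have hX : ∀ i, (MvPolynomial.X i - C (y i) : MvPolynomial ι ℂ) ∈ m := fun i => by
    simp [hm]
  have hlm : ∀ k, l k ∈ m := fun k => Ideal.sum_mem _ fun i _ => Ideal.mul_mem_left _ _ (hX i)
  have hld : ∀ k, differentialₗ b x (l k) = α k := by
    intro k
    refine b.ext fun j => ?_
    change differential b (l k) x (b j) = _
    rw [differential_apply, Finset.sum_eq_single j]
    · simp only [l, map_sum, pderiv_C_mul, map_sub, pderiv_C, sub_zero, pderiv_X]
      rw [Finset.sum_eq_single j]
      · simp
      · intro i _ hij
        simp [hij]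
      · simp
    · intro i _ hij
      simp [hij.symm]
    · simp
  set J := Ideal.span (Set.range l) with hJ
  have hJm : J ≤ m := Ideal.span_le.2 (by rintro _ ⟨k, rfl⟩; exact hlm k)
  have hsq : ∀ f ∈ m, differentialₗ b x f = 0 → f ∈ m ^ 2 := by
    intro f hf hd
    have h1 := sub_taylor_mem_sq y f
    have h2 : ∀ i, eval y (pderiv i f) = 0 := by
      intro j
      have h3 : differential b f x (b j) = 0 := by
        have := congrArg (fun g => g (b j)) hd
        exact this
      rw [differential_apply, Finset.sum_eq_single j] at h3
      · rw [hy]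
        simpa using h3
      · intro i _ hij
        simp [hij.symm]
      · simp
    rw [hm, mem_vanishingIdeal_singleton] at hf
    simpa [hf, h2] using h1
  -- The differentials of `I` and of the `l k` span `V*`, so `I` and the `l k` generate `m`
  -- modulo `m²`.
  have hcot : m ≤ (I ⊔ J) ⊔ m * m := by
    intro f hf
    obtain ⟨c, hc⟩ : ∃ c : Fin t → ℂ, D.mkQ (differentialₗ b x f) = ∑ k, c k • e k :=
      ⟨_, (e.sum_repr _).symm⟩
    have h1 : differentialₗ b x f - ∑ k, c k • α k ∈ D := by
      rw [← Submodule.ker_mkQ D, LinearMap.mem_ker, map_sub, hc, map_sum]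
      simp [hα]
    obtain ⟨g, hg, hgd⟩ := h1
    have h2 : f - g - ∑ k, c k • l k ∈ m ^ 2 := by
      refine hsq _ ?_ ?_
      · refine sub_mem (sub_mem hf (hIm hg)) (Ideal.sum_mem _ fun k _ => ?_)
        rw [MvPolynomial.smul_eq_C_mul]
        exact Ideal.mul_mem_left _ _ (hlm k)
      · rw [map_sub, map_sub, hgd, map_sum]
        simp [hld]
    have h3 : ∑ k, c k • l k ∈ J := Ideal.sum_mem _ fun k _ => by
      rw [MvPolynomial.smul_eq_C_mul]
      exact Ideal.mul_mem_left _ _ (Ideal.subset_span ⟨k, rfl⟩)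
    have : f = (g + ∑ k, c k • l k) + (f - g - ∑ k, c k • l k) := by ring
    rw [this, ← pow_two]
    exact Submodule.add_mem_sup (Submodule.add_mem_sup hg h3) h2
  -- By Nakayama's lemma some `r ∉ m` multiplies `m` into `I + J`; so a prime between `I + J`
  -- and `m` contains `m`.
  obtain ⟨r, hr, hrm⟩ := Submodule.exists_sub_one_mem_and_smul_le_of_fg_of_le_sup (I := m)
    (N := I ⊔ J) (N' := m) (P := m) (IsNoetherian.noetherian m) le_rfl hcot
  have hrm' : r ∉ m := fun h => hmax.ne_top
    ((Ideal.eq_top_iff_one _).2 (by simpa using sub_mem h hr))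
  have hmin : m.map (Ideal.Quotient.mk I) ∈
      (Ideal.span (Set.range (Ideal.Quotient.mk I ∘ l))).minimalPrimes := by
    have hspan : Ideal.span (Set.range (Ideal.Quotient.mk I ∘ l)) =
        J.map (Ideal.Quotient.mk I) := by
      rw [hJ, Ideal.map_span, Set.range_comp]
    rw [hspan]
    refine ⟨⟨map_quotientMk_isPrime hIm, Ideal.map_mono hJm⟩, fun Q hQ hQm => ?_⟩
    obtain ⟨hQp, hJQ⟩ := hQ
    have hQc : Q.comap (Ideal.Quotient.mk I) ≤ m := by
      rw [← comap_map_quotientMk hIm]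
      exact Ideal.comap_mono hQm
    have hIQ : I ≤ Q.comap (Ideal.Quotient.mk I) := by
      conv_lhs => rw [← Ideal.mk_ker (I := I)]
      exact Ideal.ker_le_comap _
    rw [Ideal.map_le_iff_le_comap]
    intro f hf
    have h1 : r * f ∈ Q.comap (Ideal.Quotient.mk I) :=
      sup_le hIQ (Ideal.map_le_iff_le_comap.1 hJQ)
        (hrm (Submodule.smul_mem_pointwise_smul f r _ hf))
    exact ((Ideal.comap_isPrime (Ideal.Quotient.mk I) Q).mem_or_mem h1).resolve_left
      fun h => hrm' (hQc h)
  refine (Ideal.height_le_card_of_mem_minimalPrimes_span (Set.finite_range _) hmin).trans ?_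
  rw [← Set.image_univ]
  have h := Set.ncard_image_le (f := Ideal.Quotient.mk I ∘ l) (Set.finite_univ (α := Fin t))
  rw [Set.ncard_univ, Nat.card_eq_fintype_card, Fintype.card_fin] at h
  exact_mod_cast h

end GenericTangent

/-! ### Homogeneous ideals of polynomials -/

section Homogeneous

open MvPolynomial

-- The grading of polynomials by degree is not a global instance in Mathlib.
attribute [local instance] MvPolynomial.gradedAlgebra

/-- Minimal primes over a homogeneous ideal are homogeneous, because the homogeneous core of a prime
is prime. -/
theorem isHomogeneous_of_mem_minimalPrimes {A : Type*} [CommRing A] [Algebra ℂ A]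
    {𝒜 : ℕ → Submodule ℂ A} [GradedRing 𝒜] {I P : Ideal A} (hI : I.IsHomogeneous 𝒜)
    (hP : P ∈ I.minimalPrimes) : P.IsHomogeneous 𝒜 := by
  have hc := P.toIdeal_homogeneousCore_le 𝒜
  have hIc : I ≤ (P.homogeneousCore 𝒜).toIdeal := by
    rw [← hI.toIdeal_homogeneousCore_eq_self]
    exact Ideal.homogeneousCore_mono 𝒜 hP.1.2
  rw [← le_antisymm hc (hP.2 ⟨hP.isPrime.homogeneousCore, hIc⟩ hc)]
  exact (P.homogeneousCore 𝒜).isHomogeneous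

variable {σ : Type*}

theorem isHomogeneous_iff_forall_homogeneousComponent_mem {P : Ideal (MvPolynomial σ ℂ)} :
    P.IsHomogeneous (homogeneousSubmodule σ ℂ) ↔ ∀ f ∈ P, ∀ d, homogeneousComponent d f ∈ P := by
  constructor
  · intro h f hf d
    have := h d hf
    rwa [← decomposition.decompose'_apply]
  · intro h d f hf
    have := h f hf d
    rwa [← decomposition.decompose'_apply] at this

theorem eval_smul_of_isHomogeneous {f : MvPolynomial σ ℂ} {d : ℕ} (hf : f.IsHomogeneous d)
    (c : ℂ) (y : σ → ℂ) : eval (c • y) f = c ^ d * eval y f := by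
  rw [eval_eq, eval_eq, Finset.mul_sum]
  refine Finset.sum_congr rfl fun m hm => ?_
  have hd : m.degree = d := by
    rw [Finsupp.degree_eq_weight_one]
    exact hf (mem_support_iff.1 hm)
  rw [Finsupp.degree_apply] at hd
  simp only [Pi.smul_apply, smul_eq_mul, mul_pow, Finset.prod_mul_distrib,
    Finset.prod_pow_eq_pow_sum]
  rw [hd]
  ring

/-- A polynomial vanishing on a punctured line through the origin has all its homogeneous
components vanishing there. -/
theorem eval_homogeneousComponent_eq_zero {f : MvPolynomial σ ℂ} {y : σ → ℂ}
    (h : ∀ c : ℂ, c ≠ 0 → eval (c • y) f = 0) (d : ℕ) : eval y (homogeneousComponent d f) = 0 := by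
  -- `q` is the restriction of `f` to the line through `y`, as a polynomial in the parameter.
  let q : Polynomial ℂ := ∑ i ∈ Finset.range (f.totalDegree + 1),
    Polynomial.monomial i (eval y (homogeneousComponent i f))
  have hq : ∀ c : ℂ, c ≠ 0 → q.eval c = 0 := by
    intro c hc
    rw [← h c hc]
    conv_rhs => rw [← sum_homogeneousComponent f]
    simp only [q, Polynomial.eval_finsetSum, Polynomial.eval_monomial, map_sum]
    refine Finset.sum_congr rfl fun i _ => ?_
    rw [eval_smul_of_isHomogeneous (homogeneousComponent_isHomogeneous i f), mul_comm]
  have hq0 : q = 0 := by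
    refine Polynomial.eq_zero_of_infinite_isRoot q (Set.Infinite.mono (s := {0}ᶜ) hq ?_)
    exact (Set.finite_singleton _).infinite_compl
  by_cases hd : d ∈ Finset.range (f.totalDegree + 1)
  · have := congrArg (fun p => Polynomial.coeff p d) hq0
    simp only [q, Polynomial.finsetSum_coeff, Polynomial.coeff_monomial] at this
    rw [Finset.sum_ite_eq' _ d, if_pos hd] at this
    simpa using this
  · rw [homogeneousComponent_eq_zero, map_zero]
    simp at hd
    omega

end Homogeneous

/-! ### Closed subsets of projective space and their ideals -/

section ProjectiveZeros

open MvPolynomial Topology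

-- The grading of polynomials by degree is not a global instance in Mathlib.
attribute [local instance] MvPolynomial.gradedAlgebra

variable {ι V : Type*} [Fintype ι] [AddCommGroup V] [Module ℂ V] (b : Module.Basis ι ℂ V)

theorem mem_idealOf {X : Set (ℙ ℂ V)} {f : MvPolynomial ι ℂ} :
    f ∈ idealOf b X ↔ ∀ (v : V) (hv : v ≠ 0), Projectivization.mk ℂ v hv ∈ X →
      eval (b.equivFun v) f = 0 := by
  simp only [idealOf, mem_vanishingIdeal_iff, Set.forall_mem_image, puncturedCone,
    Set.mem_ofPred_eq, aeval_eq_eval]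
  constructor
  · exact fun h v hv hX => h ⟨hv, hX⟩
  · rintro h v ⟨hv, hX⟩
    exact h v hv hX

theorem eval_rep_eq_zero_of_mem_idealOf {X : Set (ℙ ℂ V)} {f : MvPolynomial ι ℂ}
    (hf : f ∈ idealOf b X) {p : ℙ ℂ V} (hp : p ∈ X) : eval (b.equivFun p.rep) f = 0 :=
  (mem_idealOf b).1 hf p.rep p.rep_nonzero (by rwa [p.mk_rep])

theorem idealOf_anti {X Y : Set (ℙ ℂ V)} (h : X ⊆ Y) : idealOf b Y ≤ idealOf b X := fun _ hf =>
  (mem_idealOf b).2 fun v hv hX => (mem_idealOf b).1 hf v hv (h hX)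

theorem mk_smul_eq {v : V} (hv : v ≠ 0) {c : ℂ} (hc : c ≠ 0) :
    Projectivization.mk ℂ (c • v) (smul_ne_zero hc hv) = Projectivization.mk ℂ v hv :=
  (Projectivization.mk_eq_mk_iff' ℂ _ _ _ _).2 ⟨c, rfl⟩

theorem exists_smul_eq_rep {v : V} (hv : v ≠ 0) :
    ∃ c : ℂ, c ≠ 0 ∧ c • v = (Projectivization.mk ℂ v hv).rep := by
  obtain ⟨a, ha⟩ := Projectivization.exists_smul_eq_mk_rep ℂ v hv
  exact ⟨a, a.ne_zero, ha⟩

theorem isHomogeneous_idealOf (X : Set (ℙ ℂ V)) :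
    (idealOf b X).IsHomogeneous (homogeneousSubmodule ι ℂ) := by
  rw [isHomogeneous_iff_forall_homogeneousComponent_mem]
  intro f hf d
  rw [mem_idealOf] at hf ⊢
  intro v hv hX
  refine eval_homogeneousComponent_eq_zero (fun c hc => ?_) d
  rw [← map_smul]
  exact hf _ (smul_ne_zero hc hv) (by rwa [mk_smul_eq hv hc])

variable {b} in
theorem eval_rep_eq_zero_iff {f : MvPolynomial ι ℂ} {d : ℕ} (hf : f.IsHomogeneous d) {v : V}
    (hv : v ≠ 0) : eval (b.equivFun (Projectivization.mk ℂ v hv).rep) f = 0 ↔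
      eval (b.equivFun v) f = 0 := by
  obtain ⟨c, hc, h⟩ := exists_smul_eq_rep hv
  rw [← h, map_smul, eval_smul_of_isHomogeneous hf, mul_eq_zero, or_iff_right (pow_ne_zero d hc)]

variable {b} in
theorem mk_mem_projZeroLocus_iff {P : Ideal (MvPolynomial ι ℂ)}
    (hP : P.IsHomogeneous (homogeneousSubmodule ι ℂ)) {v : V} (hv : v ≠ 0) :
    Projectivization.mk ℂ v hv ∈ projZeroLocus b (P : Set (MvPolynomial ι ℂ)) ↔
      ∀ f ∈ P, eval (b.equivFun v) f = 0 := by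
  rw [isHomogeneous_iff_forall_homogeneousComponent_mem] at hP
  constructor
  · intro h f hf
    rw [← sum_homogeneousComponent f, map_sum]
    exact Finset.sum_eq_zero fun d _ =>
      (eval_rep_eq_zero_iff (homogeneousComponent_isHomogeneous d f) hv).1 (h _ (hP f hf d))
  · intro h f hf
    rw [← sum_homogeneousComponent f, map_sum]
    exact Finset.sum_eq_zero fun d _ =>
      (eval_rep_eq_zero_iff (homogeneousComponent_isHomogeneous d f) hv).2 (h _ (hP f hf d))

theorem isClosed_iff_exists_projZeroLocus {X : Set (ℙ ℂ V)} :
    IsClosed[zariskiTopology b] X ↔ ∃ S : Set (MvPolynomial ι ℂ),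
      (∀ f ∈ S, ∃ d, f.IsHomogeneous d) ∧ X = projZeroLocus b S := by
  rw [← @isOpen_compl_iff _ _ (zariskiTopology b)]
  change Xᶜᶜ ∈ _ ↔ _
  rw [compl_compl]
  rfl

variable {b} in
theorem isClosed_projZeroLocus {P : Ideal (MvPolynomial ι ℂ)}
    (hP : P.IsHomogeneous (homogeneousSubmodule ι ℂ)) :
    IsClosed[zariskiTopology b] (projZeroLocus b (P : Set (MvPolynomial ι ℂ))) := by
  rw [isClosed_iff_exists_projZeroLocus]
  refine ⟨{f | f ∈ P ∧ ∃ d, f.IsHomogeneous d}, fun f hf => hf.2, ?_⟩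
  refine subset_antisymm (fun p hp f hf => hp f hf.1) fun p hp f hf => ?_
  rw [isHomogeneous_iff_forall_homogeneousComponent_mem] at hP
  rw [← sum_homogeneousComponent f, map_sum]
  exact Finset.sum_eq_zero fun d _ =>
    hp _ ⟨hP f hf d, d, homogeneousComponent_isHomogeneous d f⟩

variable {b} in
theorem projZeroLocus_idealOf {X : Set (ℙ ℂ V)} (hX : IsClosed[zariskiTopology b] X) :
    projZeroLocus b (idealOf b X : Set (MvPolynomial ι ℂ)) = X := by
  refine subset_antisymm (fun p hp => ?_) fun p hp f hf => eval_rep_eq_zero_of_mem_idealOf b hf hp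
  obtain ⟨S, hS, rfl⟩ := (isClosed_iff_exists_projZeroLocus b).1 hX
  intro f hf
  refine hp f ((mem_idealOf b).2 fun v hv hv' => ?_)
  obtain ⟨d, hd⟩ := hS f hf
  exact (eval_rep_eq_zero_iff hd hv).1 (hv' f hf)

variable {b} in
theorem subset_of_idealOf_le {X Y : Set (ℙ ℂ V)} (hY : IsClosed[zariskiTopology b] Y)
    (h : idealOf b Y ≤ idealOf b X) : X ⊆ Y := by
  rw [← projZeroLocus_idealOf hY]
  exact fun p hp f hf => eval_rep_eq_zero_of_mem_idealOf b (h hf) hp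

theorem idealOf_ne_top {X : Set (ℙ ℂ V)} (hX : X.Nonempty) : idealOf b X ≠ ⊤ := by
  obtain ⟨p, hp⟩ := hX
  intro h
  have := eval_rep_eq_zero_of_mem_idealOf b (f := 1) (by rw [h]; trivial) hp
  simp at this

theorem idealOf_empty : idealOf b (∅ : Set (ℙ ℂ V)) = ⊤ :=
  (Ideal.eq_top_iff_one _).2 ((mem_idealOf b).2 fun _ _ h => h.elim)

variable {b} in
theorem isPrime_idealOf {Z : Set (ℙ ℂ V)} (hZ : @IsIrreducible _ (zariskiTopology b) Z) :
    (idealOf b Z).IsPrime := by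
  let := zariskiTopology b
  refine (isHomogeneous_idealOf b Z).isPrime_of_homogeneous_mem_or_mem
    (idealOf_ne_top b hZ.nonempty) ?_
  rintro f g ⟨d, hf⟩ ⟨e, hg⟩ hfg
  have hcl : ∀ (f : MvPolynomial ι ℂ) (d : ℕ), f.IsHomogeneous d →
      IsClosed (projZeroLocus b {f}) := fun f d hf =>
    (isClosed_iff_exists_projZeroLocus b).2 ⟨{f}, by rintro _ rfl; exact ⟨d, hf⟩, rfl⟩
  have hle : ∀ (f : MvPolynomial ι ℂ) (d : ℕ), f.IsHomogeneous d → Z ⊆ projZeroLocus b {f} →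
      f ∈ idealOf b Z := fun f d hf h =>
    (mem_idealOf b).2 fun v hv hvZ => (eval_rep_eq_zero_iff hf hv).1 (h hvZ f rfl)
  have := isPreirreducible_iff_isClosed_union_isClosed.1 hZ.isPreirreducible _ _
    (hcl f d hf) (hcl g e hg) (fun p hp => by
      have := eval_rep_eq_zero_of_mem_idealOf b hfg hp
      rw [map_mul, mul_eq_zero] at this
      exact this.imp (fun h => by rintro _ rfl; exact h) (fun h => by rintro _ rfl; exact h))
  exact this.imp (hle f d hf) (hle g e hg)

variable {b} in
/-- The converse of `isPrime_idealOf`; the subset need not be closed. -/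
theorem isIrreducible_of_isPrime_idealOf {Z : Set (ℙ ℂ V)} (hZ : (idealOf b Z).IsPrime) :
    @IsIrreducible _ (zariskiTopology b) Z := by
  let := zariskiTopology b
  refine ⟨?_, isPreirreducible_iff_isClosed_union_isClosed.2 fun Z₁ Z₂ h₁ h₂ h => ?_⟩
  · by_contra hne
    rw [Set.not_nonempty_iff_eq_empty] at hne
    exact hZ.ne_top (hne ▸ idealOf_empty b)
  · have hmul : idealOf b Z₁ * idealOf b Z₂ ≤ idealOf b Z := Ideal.mul_le.2 fun f hf g hg =>
      (mem_idealOf b).2 fun v hv hvZ => by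
        rw [map_mul, mul_eq_zero]
        exact (h hvZ).imp ((mem_idealOf b).1 hf v hv) ((mem_idealOf b).1 hg v hv)
    exact (hZ.mul_le.1 hmul).imp (subset_of_idealOf_le h₁) (subset_of_idealOf_le h₂)

end ProjectiveZeros

/-! ### Irreducible components and minimal primes -/

section Components

open MvPolynomial Topology

-- The grading of polynomials by degree is not a global instance in Mathlib.
attribute [local instance] MvPolynomial.gradedAlgebra

variable {ι V : Type*} [Fintype ι] [AddCommGroup V] [Module ℂ V] {b : Module.Basis ι ℂ V}

/-- A minimal prime over a radical ideal agrees with it locally: over a noetherian ring a single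
element outside the prime multiplies the whole prime into the ideal. -/
theorem exists_notMem_forall_mul_mem {R : Type*} [CommRing R] [IsNoetherianRing R] {I P : Ideal R}
    (hI : I.IsRadical) (hP : P ∈ I.minimalPrimes) : ∃ g ∉ P, ∀ f ∈ P, g * f ∈ I := by
  have hPp := hP.isPrime
  obtain ⟨T, hT⟩ := IsNoetherian.noetherian P
  have key : ∀ x ∈ P, ∃ t ∉ P, t * x ∈ I := by
    intro x hx
    obtain ⟨t, ht, n, h⟩ := exists_notMem_mul_pow_mem_of_mem_minimalPrimes hP hx
    refine ⟨t, ht, hI ⟨n + 1, ?_⟩⟩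
    have : (t * x) ^ (n + 1) = t ^ n * x * (t * x ^ n) := by ring
    rw [this]
    exact I.mul_mem_left _ h
  choose! t ht htI using key
  have hTP : ∀ x ∈ T, x ∈ P := fun x hx => hT ▸ Submodule.subset_span hx
  refine ⟨∏ x ∈ T, t x, fun h => ?_, fun f hf => ?_⟩
  · obtain ⟨x, hx, hxP⟩ := hPp.prod_mem_iff.1 h
    exact ht x (hTP x hx) hxP
  · rw [← hT] at hf
    induction hf using Submodule.span_induction with
    | mem x hx =>
      obtain ⟨c, hc⟩ := Finset.dvd_prod_of_mem t hx
      rw [hc, mul_right_comm]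
      exact I.mul_mem_right _ (htI x (hTP x hx))
    | zero => simp
    | add x y _ _ hx hy => rw [mul_add]; exact I.add_mem hx hy
    | smul a x _ hx =>
      rw [smul_eq_mul, mul_left_comm]
      exact I.mul_mem_left _ hx

theorem isRadical_idealOf (b : Module.Basis ι ℂ V) (X : Set (ℙ ℂ V)) :
    (idealOf b X).IsRadical := by
  rintro f ⟨n, hf⟩
  rw [mem_idealOf] at hf ⊢
  intro v hv hX
  have := hf v hv hX
  rw [map_pow] at this
  exact eq_zero_of_pow_eq_zero this

/-- No Nullstellensatz is needed: for `g ∉ P` with `g P ⊆ I(X)`, a polynomial `h` vanishing on the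
part of `X` cut out by `P` satisfies `g h ∈ I(X) ⊆ P`. -/
theorem idealOf_inter_projZeroLocus {X : Set (ℙ ℂ V)} {P : Ideal (MvPolynomial ι ℂ)}
    (hP : P ∈ (idealOf b X).minimalPrimes) :
    idealOf b (X ∩ projZeroLocus b (P : Set (MvPolynomial ι ℂ))) = P := by
  have hPh := isHomogeneous_of_mem_minimalPrimes (isHomogeneous_idealOf b X) hP
  obtain ⟨g, hg, hgP⟩ := exists_notMem_forall_mul_mem (isRadical_idealOf b X) hP
  refine le_antisymm (fun h hh => ?_) fun f hf =>
    (mem_idealOf b).2 fun v hv hvX => (mk_mem_projZeroLocus_iff hPh hv).1 hvX.2 f hf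
  refine (hP.isPrime.mem_or_mem (hP.1.2 ((mem_idealOf b).2 fun v hv hvX => ?_))).resolve_left hg
  rw [map_mul, mul_eq_zero]
  by_cases hvP : Projectivization.mk ℂ v hv ∈ projZeroLocus b (P : Set (MvPolynomial ι ℂ))
  · exact Or.inr ((mem_idealOf b).1 hh v hv ⟨hvX, hvP⟩)
  · rw [mk_mem_projZeroLocus_iff hPh hv] at hvP
    push Not at hvP
    obtain ⟨f, hf, hfv⟩ := hvP
    have := (mem_idealOf b).1 (hgP f hf) v hv hvX
    rw [map_mul, mul_eq_zero] at this
    exact Or.inl (this.resolve_right hfv)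

theorem isIrreducibleComponent_inter_projZeroLocus {X : Set (ℙ ℂ V)}
    {P : Ideal (MvPolynomial ι ℂ)} (hP : P ∈ (idealOf b X).minimalPrimes) :
    IsIrreducibleComponent b X (X ∩ projZeroLocus b (P : Set (MvPolynomial ι ℂ))) := by
  have hPe := idealOf_inter_projZeroLocus hP
  refine ⟨⟨Set.inter_subset_left, isIrreducible_of_isPrime_idealOf (b := b) ?_⟩, fun W hW hle => ?_⟩
  · rw [hPe]
    exact hP.isPrime
  · have hle' := idealOf_anti b hle
    rw [hPe] at hle'
    have hPW := hP.2 ⟨isPrime_idealOf hW.2, idealOf_anti b hW.1⟩ hle'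
    exact fun p hp => ⟨hW.1 hp, fun f hf => eval_rep_eq_zero_of_mem_idealOf b (hPW hf) hp⟩

/-- The irreducible components of a projective variety are closed and their ideals are the minimal
primes over its ideal; see `isIrreducibleComponent_inter_projZeroLocus` for the converse. -/
theorem idealOf_mem_minimalPrimes {X Z : Set (ℙ ℂ V)} (hX : IsClosed[zariskiTopology b] X)
    (hZ : IsIrreducibleComponent b X Z) :
    IsClosed[zariskiTopology b] Z ∧ idealOf b Z ∈ (idealOf b X).minimalPrimes := by
  have := isPrime_idealOf hZ.1.2
  obtain ⟨P, hP, hPZ⟩ := Ideal.exists_minimalPrimes_le (idealOf_anti b hZ.1.1)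
  have hPe := idealOf_inter_projZeroLocus hP
  have hPh := isHomogeneous_of_mem_minimalPrimes (isHomogeneous_idealOf b X) hP
  have hcl : IsClosed[zariskiTopology b] (X ∩ projZeroLocus b (P : Set (MvPolynomial ι ℂ))) :=
    @IsClosed.inter _ _ _ (zariskiTopology b) hX (isClosed_projZeroLocus hPh)
  have hsub := subset_of_idealOf_le hcl (hPe.trans_le hPZ)
  have heq := hsub.antisymm (hZ.2 (isIrreducibleComponent_inter_projZeroLocus hP).1 hsub)
  rw [heq, hPe]
  exact ⟨hcl, hP⟩

end Components

/-! ### Dimension of projective varieties -/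

section Dimension

open MvPolynomial Topology

-- The grading of polynomials by degree is not a global instance in Mathlib.
attribute [local instance] MvPolynomial.gradedAlgebra

variable {ι V : Type*} [Fintype ι] [AddCommGroup V] [Module ℂ V] {b : Module.Basis ι ℂ V}

theorem affineDim_quotient_vanishingIdeal_singleton {σ : Type*} (y : σ → ℂ) :
    affineDim ℂ (MvPolynomial σ ℂ ⧸ vanishingIdeal ℂ {y}) = 0 := by
  have : Algebra.IsAlgebraic ℂ (MvPolynomial σ ℂ ⧸ vanishingIdeal ℂ {y}) := by
    refine ⟨fun z => ?_⟩
    obtain ⟨f, rfl⟩ := Ideal.Quotient.mk_surjective z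
    have : Ideal.Quotient.mk (vanishingIdeal ℂ {y}) f =
        algebraMap ℂ (MvPolynomial σ ℂ ⧸ vanishingIdeal ℂ {y}) (eval y f) := by
      change _ = Ideal.Quotient.mk (vanishingIdeal ℂ {y}) (C (eval y f))
      rw [Ideal.Quotient.eq, mem_vanishingIdeal_singleton]
      simp
    rw [this]
    exact isAlgebraic_algebraMap _
  simp [affineDim, trdeg_eq_zero]

/-- A proper homogeneous ideal is contained in the irrelevant ideal, the maximal ideal of the
origin. -/
theorem le_vanishingIdeal_zero {σ : Type*} {P : Ideal (MvPolynomial σ ℂ)} (hP : P ≠ ⊤)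
    (hPh : P.IsHomogeneous (homogeneousSubmodule σ ℂ)) : P ≤ vanishingIdeal ℂ {(0 : σ → ℂ)} := by
  intro f hf
  rw [mem_vanishingIdeal_singleton]
  have h := (isHomogeneous_iff_forall_homogeneousComponent_mem.1 hPh) f hf 0
  rw [homogeneousComponent_zero] at h
  by_contra h0
  refine hP (Ideal.eq_top_of_isUnit_mem _ h (IsUnit.map _ (Ne.isUnit fun h1 => h0 ?_)))
  rw [MvPolynomial.eval_zero]
  exact h1

theorem idealOf_ne_vanishingIdeal_zero {Z : Set (ℙ ℂ V)} (hZ : Z.Nonempty) :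
    idealOf b Z ≠ vanishingIdeal ℂ {(0 : ι → ℂ)} := by
  obtain ⟨p, hp⟩ := hZ
  intro h
  refine p.rep_nonzero (b.ext_elem fun i => ?_)
  have := eval_rep_eq_zero_of_mem_idealOf b (f := X i)
    (by rw [h, mem_vanishingIdeal_singleton]; simp) hp
  simpa using this

/-- The projective Nullstellensatz for primes. -/
theorem idealOf_projZeroLocus {P : Ideal (MvPolynomial ι ℂ)} (hP : P.IsPrime)
    (hPh : P.IsHomogeneous (homogeneousSubmodule ι ℂ)) (h0 : P ≠ vanishingIdeal ℂ {(0 : ι → ℂ)}) :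
    idealOf b (projZeroLocus b (P : Set (MvPolynomial ι ℂ))) = P := by
  obtain ⟨i, hi⟩ : ∃ i, (X i : MvPolynomial ι ℂ) ∉ P := by
    by_contra! h
    refine h0 (le_antisymm (le_vanishingIdeal_zero hP.ne_top hPh) ?_)
    rw [← IsPrime.vanishingIdeal_zeroLocus (K := ℂ) P]
    refine vanishingIdeal_anti_mono fun y hy => ?_
    have : y = 0 := funext fun i => by simpa using hy _ (h i)
    simp [this]
  refine le_antisymm (fun f hf => ?_) fun f hf =>
    (mem_idealOf b).2 fun v hv hvP => (mk_mem_projZeroLocus_iff hPh hv).1 hvP f hf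
  have hXf : X i * f ∈ P := by
    rw [← IsPrime.vanishingIdeal_zeroLocus (K := ℂ) P, mem_vanishingIdeal_iff]
    intro y hy
    obtain ⟨v, rfl⟩ := b.equivFun.surjective y
    rw [aeval_eq_eval, map_mul, mul_eq_zero, eval_X]
    rcases eq_or_ne v 0 with rfl | hv
    · left
      simp
    · right
      refine (mem_idealOf b).1 hf v hv ((mk_mem_projZeroLocus_iff hPh hv).2 fun g hg => ?_)
      simpa [aeval_eq_eval] using hy g hg
  exact (hP.mem_or_mem hXf).resolve_left hi

variable (b) in
/-- The dimension of the affine cone over a subset `Z` of projective space, as the transcendence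
degree of its coordinate ring. It is meant for irreducible `Z`. -/
noncomputable def coneDim (Z : Set (ℙ ℂ V)) : ℕ :=
  affineDim ℂ (MvPolynomial ι ℂ ⧸ idealOf b Z)

theorem coneDim_pos {Z : Set (ℙ ℂ V)} (hZ : @IsIrreducible _ (zariskiTopology b) Z) :
    0 < coneDim b Z := by
  have := isPrime_idealOf hZ
  have hlt : idealOf b Z < vanishingIdeal ℂ {(0 : ι → ℂ)} :=
    lt_of_le_of_ne (le_vanishingIdeal_zero this.ne_top (isHomogeneous_idealOf b Z))
      (idealOf_ne_vanishingIdeal_zero hZ.1)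
  have := affineDim_quotient_lt_of_lt ℂ hlt
  exact (Nat.zero_le _).trans_lt this

theorem coneDim_lt_of_ssubset {Z W : Set (ℙ ℂ V)} (hZ : @IsIrreducible _ (zariskiTopology b) Z)
    (hW : @IsIrreducible _ (zariskiTopology b) W) (hZc : IsClosed[zariskiTopology b] Z)
    (h : Z ⊂ W) : coneDim b Z < coneDim b W := by
  have := isPrime_idealOf hZ
  have := isPrime_idealOf hW
  refine affineDim_quotient_lt_of_lt ℂ (lt_of_le_not_ge (idealOf_anti b h.1) fun hle => ?_)
  exact h.2 (subset_of_idealOf_le hZc hle)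

/-- An irreducible projective variety that is not a point has a closed irreducible subset of
codimension one, cut out by a minimal prime over a homogeneous element. -/
theorem exists_ssubset_coneDim_add_one {Z : Set (ℙ ℂ V)}
    (hZ : @IsIrreducible _ (zariskiTopology b) Z) (hZc : IsClosed[zariskiTopology b] Z)
    (hd : 2 ≤ coneDim b Z) : ∃ W ⊂ Z, @IsIrreducible _ (zariskiTopology b) W ∧
      IsClosed[zariskiTopology b] W ∧ coneDim b W + 1 = coneDim b Z := by
  have hp := isPrime_idealOf hZ
  have hh := isHomogeneous_idealOf b Z
  have hle := le_vanishingIdeal_zero hp.ne_top hh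
  obtain ⟨i, hi⟩ : ∃ i, (X i : MvPolynomial ι ℂ) ∉ idealOf b Z := by
    by_contra! h
    obtain ⟨p, hpZ⟩ := hZ.1
    refine p.rep_nonzero (b.ext_elem fun i => ?_)
    simpa using eval_rep_eq_zero_of_mem_idealOf b (h i) hpZ
  obtain ⟨Q, hQ, hQ0, hQd⟩ := exists_minimalPrimes_affineDim_add_one ℂ
    (M := vanishingIdeal ℂ {(0 : ι → ℂ)}) hle (f := X i)
    (by rw [mem_vanishingIdeal_singleton]; simp) hi
  have hQp := hQ.isPrime
  have hQh : Q.IsHomogeneous (homogeneousSubmodule ι ℂ) := by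
    refine isHomogeneous_of_mem_minimalPrimes (hh.sup (Ideal.homogeneous_span _ _ ?_)) hQ
    rintro _ rfl
    exact ⟨1, isHomogeneous_X ℂ i⟩
  have hQne : Q ≠ vanishingIdeal ℂ {(0 : ι → ℂ)} := by
    rintro rfl
    rw [affineDim_quotient_vanishingIdeal_singleton] at hQd
    unfold coneDim at hd
    omega
  have hQe := idealOf_projZeroLocus (b := b) hQp hQh hQne
  have hsub : projZeroLocus b (Q : Set (MvPolynomial ι ℂ)) ⊆ Z :=
    subset_of_idealOf_le hZc (by rw [hQe]; exact le_sup_left.trans hQ.1.2)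
  refine ⟨projZeroLocus b (Q : Set (MvPolynomial ι ℂ)), ⟨hsub, fun h => hi ?_⟩,
    isIrreducible_of_isPrime_idealOf (by rwa [hQe]), isClosed_projZeroLocus hQh, ?_⟩
  · refine idealOf_anti b h ?_
    rw [hQe]
    exact (le_sup_right.trans hQ.1.2) (Ideal.mem_span_singleton_self _)
  · unfold coneDim
    rw [hQe]
    exact hQd

/-- An irreducible closed subset whose cone has dimension greater than `d` is the top of a strictly
increasing chain of length `d` of irreducible closed subsets. -/
theorem le_height_irreducibleCloseds (d : ℕ) :
    letI := zariskiTopology b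
    ∀ Z : TopologicalSpace.IrreducibleCloseds (ℙ ℂ V), d < coneDim b (Z : Set (ℙ ℂ V)) →
      (d : ℕ∞) ≤ Order.height Z := by
  let := zariskiTopology b
  induction d with
  | zero => simp
  | succ d ih =>
    intro Z hZ
    obtain ⟨W, hWZ, hWi, hWc, hWd⟩ := exists_ssubset_coneDim_add_one Z.isIrreducible Z.isClosed
      (by omega)
    have h1 := ih ⟨W, hWi, hWc⟩ (by change d < coneDim b W; omega)
    have h2 : (⟨W, hWi, hWc⟩ : TopologicalSpace.IrreducibleCloseds (ℙ ℂ V)) < Z := hWZ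
    push_cast
    exact (by gcongr : (d : ℕ∞) + 1 ≤ _).trans (Order.height_add_one_le h2)

/-- The cone over an irreducible projective variety has one dimension more than the variety; as the
cone has positive dimension, the subtraction does not truncate. -/
theorem projDim_eq {Z : Set (ℙ ℂ V)} (hZ : @IsIrreducible _ (zariskiTopology b) Z)
    (hZc : IsClosed[zariskiTopology b] Z) :
    projDim b Z = ((coneDim b Z - 1 : ℕ) : WithBot ℕ∞) := by
  let := zariskiTopology b
  let Z₀ : TopologicalSpace.IrreducibleCloseds (ℙ ℂ V) := ⟨Z, hZ, hZc⟩
  have hpos := coneDim_pos hZ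
  change Order.krullDim (TopologicalSpace.IrreducibleCloseds Z) = _
  refine le_antisymm ?_ ?_
  · let ψ : TopologicalSpace.IrreducibleCloseds (ℙ ℂ V) → ℕ := fun W =>
      coneDim b (W : Set (ℙ ℂ V)) - 1
    have hψ : StrictMono ψ := fun W W' h => by
      have h1 := coneDim_lt_of_ssubset W.isIrreducible W'.isIrreducible W.isClosed h
      have h2 := coneDim_pos W.isIrreducible
      simp only [ψ]
      omega
    rw [Order.krullDim_eq_iSup_height]
    refine iSup_le fun W => ?_
    have h1 := Order.height_le_height_apply_of_strictMono _ (hψ.comp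
      (TopologicalSpace.IrreducibleCloseds.map_strictMono_of_isInducing
        (IsInducing.subtypeVal (t := Z)))) W
    rw [Order.height_nat] at h1
    have hle :
        TopologicalSpace.IrreducibleCloseds.map Subtype.val continuous_subtype_val W ≤ Z₀ := by
      change closure (Subtype.val '' (W : Set Z)) ⊆ Z
      exact closure_minimal (by rintro _ ⟨p, -, rfl⟩; exact p.2) hZc
    have h2 := hψ.monotone hle
    have h3 : Order.height W ≤ ((coneDim b Z - 1 : ℕ) : ℕ∞) := h1.trans (by exact_mod_cast h2)
    exact WithBot.coe_le_coe.2 h3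
  · have h1 := le_height_irreducibleCloseds (b := b) (coneDim b Z - 1) Z₀
      (by change _ < coneDim b Z; omega)
    have h2 : (((coneDim b Z - 1 : ℕ) : ℕ∞) : WithBot ℕ∞) ≤ Order.krullDim (Set.Iic Z₀) := by
      rw [← Order.height_eq_krullDim_Iic]
      exact_mod_cast h1
    refine h2.trans ?_
    have hirr : ∀ W : Set.Iic Z₀, IsIrreducible (Subtype.val ⁻¹' (W.1 : Set (ℙ ℂ V)) : Set Z) := by
      rintro ⟨W, hW⟩
      refine ⟨?_, isPreirreducible_iff_isClosed_union_isClosed.2 fun z₁ z₂ hz₁ hz₂ h => ?_⟩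
      · obtain ⟨p, hp⟩ := W.isIrreducible.nonempty
        exact ⟨⟨p, hW hp⟩, hp⟩
      · obtain ⟨t₁, ht₁, rfl⟩ := isClosed_induced_iff.1 hz₁
        obtain ⟨t₂, ht₂, rfl⟩ := isClosed_induced_iff.1 hz₂
        have := isPreirreducible_iff_isClosed_union_isClosed.1 W.isIrreducible.isPreirreducible
          t₁ t₂ ht₁ ht₂ (fun p hp => h (a := ⟨p, hW hp⟩) hp)
        exact this.imp (fun h p hp => h hp) (fun h p hp => h hp)
    refine Order.krullDim_le_of_strictMono
      (fun W : Set.Iic Z₀ => (⟨Subtype.val ⁻¹' (W.1 : Set (ℙ ℂ V)), hirr W,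
        W.1.isClosed.preimage continuous_subtype_val⟩ : TopologicalSpace.IrreducibleCloseds Z))
      fun W W' h => ?_
    refine lt_of_le_not_ge (fun p hp => h.le hp) fun hle => h.not_ge fun p hp => ?_
    exact hle (x := ⟨p, W'.2 hp⟩) hp

end Dimension

/-! ### Density of the smooth points -/

section SmoothPoints

open MvPolynomial Topology

-- The grading of polynomials by degree is not a global instance in Mathlib.
attribute [local instance] MvPolynomial.gradedAlgebra

variable {ι V : Type*} [Fintype ι] [AddCommGroup V] [Module ℂ V] {b : Module.Basis ι ℂ V}

theorem differential_mul_of_eval_eq_zero {f : MvPolynomial ι ℂ} (g : MvPolynomial ι ℂ) {x : V}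
    (hf : eval (b.equivFun x) f = 0) :
    differential b (g * f) x = eval (b.equivFun x) g • differential b f x := by
  simp only [differential, pderiv_mul, map_add, map_mul, hf, mul_zero, zero_add, Finset.smul_sum,
    smul_smul]

theorem le_vanishingIdeal_of_mem_puncturedCone {X : Set (ℙ ℂ V)} {x : V}
    (hx : x ∈ puncturedCone X) : idealOf b X ≤ vanishingIdeal ℂ {b.equivFun x} :=
  vanishingIdeal_anti_mono (Set.singleton_subset_iff.2 ⟨x, hx, rfl⟩)

/-- Generic smoothness: on each component of the cone, given by a minimal prime `P`, the points
where some `h ∉ P` does not vanish are smooth. There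
`dim V(P) ≤ dim_x ≤ dim T_x ≤ dim V(P)`. -/
theorem exists_notMem_forall_mem_smoothCone {X : Set (ℙ ℂ V)} {P : Ideal (MvPolynomial ι ℂ)}
    (hP : P ∈ (idealOf b X).minimalPrimes) :
    ∃ h ∉ P, ∀ x ∈ puncturedCone X, (∀ f ∈ P, eval (b.equivFun x) f = 0) →
      eval (b.equivFun x) h ≠ 0 → x ∈ smoothCone b X ∧
        Module.finrank ℂ (tangentSpace b X x) = affineDim ℂ (MvPolynomial ι ℂ ⧸ P) := by
  have hPp := hP.isPrime
  obtain ⟨g, hg, hgP⟩ := exists_notMem_forall_mul_mem (isRadical_idealOf b X) hP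
  obtain ⟨h, hh, hT⟩ := exists_finrank_tangent_le_affineDim b P
  refine ⟨g * h, fun hm => (hPp.mem_or_mem hm).elim hg hh, fun x hx hxP hgh => ?_⟩
  rw [map_mul] at hgh
  have h1 : Module.finrank ℂ (tangentSpace b X x) ≤ affineDim ℂ (MvPolynomial ι ℂ ⧸ P) := by
    refine hT x (right_ne_zero_of_mul hgh) _ fun v hv f hf => ?_
    have := hv _ (hgP f hf)
    rw [differential_mul_of_eval_eq_zero g (hxP f hf), LinearMap.smul_apply, smul_eq_mul] at this
    exact (mul_eq_zero.1 this).resolve_left (left_ne_zero_of_mul hgh)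
  have h2 := coneDimAt_le_finrank_tangentSpace b X hx
  have h3 : (affineDim ℂ (MvPolynomial ι ℂ ⧸ P) : ℕ∞) ≤ coneDimAt b X x :=
    affineDim_quotient_le_height ℂ hP.1.2
      (fun f hf => mem_vanishingIdeal_singleton.2 (hxP f hf))
      (affineDim_quotient_vanishingIdeal_singleton _)
  have h4 : Module.finrank ℂ (tangentSpace b X x) = affineDim ℂ (MvPolynomial ι ℂ ⧸ P) :=
    le_antisymm h1 (by exact_mod_cast h3.trans h2)
  refine ⟨⟨hx, le_antisymm ?_ h2⟩, h4⟩
  rw [h4]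
  exact h3

/-- A polynomial vanishing at all smooth points of the cone vanishes on the whole cone. -/
theorem mem_idealOf_of_forall_mem_smoothCone {X : Set (ℙ ℂ V)} {f : MvPolynomial ι ℂ}
    (hf : ∀ x ∈ smoothCone b X, eval (b.equivFun x) f = 0) : f ∈ idealOf b X := by
  rw [← (isRadical_idealOf b X).radical, ← Ideal.sInf_minimalPrimes, Submodule.mem_sInf]
  intro P hP
  obtain ⟨h, hh, hs⟩ := exists_notMem_forall_mem_smoothCone hP
  have hPh := isHomogeneous_of_mem_minimalPrimes (isHomogeneous_idealOf b X) hP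
  refine ((Ideal.IsPrime.mem_or_mem hP.isPrime) ?_).resolve_left hh
  rw [← idealOf_inter_projZeroLocus hP, mem_idealOf]
  intro v hv hvX
  rw [map_mul, mul_eq_zero]
  by_contra! hne
  exact hne.2 (hf v (hs v ⟨hv, hvX.1⟩ ((mk_mem_projZeroLocus_iff hPh hv).1 hvX.2) hne.1).1)

theorem exists_mem_smoothCone_finrank_eq {X : Set (ℙ ℂ V)} {P : Ideal (MvPolynomial ι ℂ)}
    (hP : P ∈ (idealOf b X).minimalPrimes) :
    ∃ x ∈ smoothCone b X,
      Module.finrank ℂ (tangentSpace b X x) = affineDim ℂ (MvPolynomial ι ℂ ⧸ P) := by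
  obtain ⟨h, hh, hs⟩ := exists_notMem_forall_mem_smoothCone hP
  have hPh := isHomogeneous_of_mem_minimalPrimes (isHomogeneous_idealOf b X) hP
  rw [← idealOf_inter_projZeroLocus hP, mem_idealOf] at hh
  push Not at hh
  obtain ⟨v, hv, hvX, hne⟩ := hh
  exact ⟨v, hs v ⟨hv, hvX.1⟩ ((mk_mem_projZeroLocus_iff hPh hv).1 hvX.2) hne⟩

end SmoothPoints

/-! ### Lagrangian subspaces -/

section Lagrangian

variable {V : Type*} [AddCommGroup V] [Module ℂ V] {ω : LinearMap.BilinForm ℂ V}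

theorem IsLagrangian.orthogonal_eq (hω : ω.IsAlt) {W : Submodule ℂ V} (hW : IsLagrangian ω W) :
    ω.orthogonal W = W := by
  refine le_antisymm (fun v hv => ?_) fun v hv w hw => hW.1 w hw v hv
  have hiso : ∀ u ∈ W ⊔ ℂ ∙ v, ∀ u' ∈ W ⊔ ℂ ∙ v, ω u u' = 0 := by
    intro u hu u' hu'
    obtain ⟨w, hw, z, hz, rfl⟩ := Submodule.mem_sup.1 hu
    obtain ⟨w', hw', z', hz', rfl⟩ := Submodule.mem_sup.1 hu'
    obtain ⟨c, rfl⟩ := Submodule.mem_span_singleton.1 hz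
    obtain ⟨c', rfl⟩ := Submodule.mem_span_singleton.1 hz'
    have h1 : ω w v = 0 := hv w hw
    have h2 : ω v w' = 0 := hω.isRefl _ _ (hv w' hw')
    simp [hW.1 w hw w' hw', h1, h2, hω v]
  exact hW.2 hiso le_sup_left (Submodule.mem_sup_right (Submodule.mem_span_singleton_self v))

variable [FiniteDimensional ℂ V]

theorem IsLagrangian.finrank_eq (hω : IsSymplectic ω) {n : ℕ} (hn : Module.finrank ℂ V = 2 * n)
    {W : Submodule ℂ V} (hW : IsLagrangian ω W) : Module.finrank ℂ W = n := by
  have h := LinearMap.BilinForm.finrank_orthogonal hω.nondegenerate W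
  rw [hW.orthogonal_eq hω.alt] at h
  have := W.finrank_le
  omega

theorem isLagrangian_of_orthogonal_le (hω : IsSymplectic ω) {n : ℕ}
    (hn : Module.finrank ℂ V = 2 * n) {W : Submodule ℂ V} (hW : ω.orthogonal W ≤ W)
    (hd : Module.finrank ℂ W ≤ n) : IsLagrangian ω W := by
  have h := LinearMap.BilinForm.finrank_orthogonal hω.nondegenerate W
  have heq : ω.orthogonal W = W := Submodule.eq_of_le_of_finrank_le hW (by omega)
  refine ⟨fun u hu v hv => ?_, fun U hU hWU u hu => ?_⟩
  · rw [← heq] at hv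
    exact hv u hu
  · rw [← heq]
    exact fun w hw => hU w (hWU hw) u hu

end Lagrangian

/-! ### Legendrian varieties and the Poisson bracket -/

section Legendrian

open MvPolynomial Topology

variable {ι V : Type*} [Fintype ι] [AddCommGroup V] [Module ℂ V] [FiniteDimensional ℂ V]
  {b : Module.Basis ι ℂ V} {ω : LinearMap.BilinForm ℂ V} {X : Set (ℙ ℂ V)}

theorem IsLegendrian.poissonBracket_mem (hω : IsSymplectic ω) (hX : IsLegendrian b ω X)
    {f g : MvPolynomial ι ℂ} (hf : f ∈ idealOf b X) (hg : g ∈ idealOf b X) :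
    poissonBracket b ω hω f g ∈ idealOf b X := by
  refine mem_idealOf_of_forall_mem_smoothCone fun x hx => ?_
  rw [eval_poissonBracket, dualForm, LinearMap.BilinForm.apply_toDual_symm_apply]
  have hmem : (ω.toDual hω.nondegenerate).symm (differential b g x) ∈ tangentSpace b X x := by
    rw [← (hX x hx).orthogonal_eq hω.alt]
    intro t ht
    refine hω.alt.isRefl _ _ ?_
    rw [LinearMap.BilinForm.apply_toDual_symm_apply]
    exact ht g hg
  exact hmem f hf

theorem IsLegendrian.affineDim_eq (hω : IsSymplectic ω) (hX : IsLegendrian b ω X) {n : ℕ}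
    (hn : Module.finrank ℂ V = 2 * n) {P : Ideal (MvPolynomial ι ℂ)}
    (hP : P ∈ (idealOf b X).minimalPrimes) : affineDim ℂ (MvPolynomial ι ℂ ⧸ P) = n := by
  obtain ⟨x, hx, hd⟩ := exists_mem_smoothCone_finrank_eq hP
  rw [← hd, (hX x hx).finrank_eq hω hn]

/-- If the ideal is closed under the bracket, every tangent space contains its orthogonal: a vector
orthogonal to the tangent space at `x` is `φ⁻¹ (df_x)` for some `f` in the ideal. -/
theorem orthogonal_tangentSpace_le (hω : IsSymplectic ω)
    (h : ∀ f ∈ idealOf b X, ∀ g ∈ idealOf b X, poissonBracket b ω hω f g ∈ idealOf b X)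
    {x : V} (hx : x ∈ puncturedCone X) :
    ω.orthogonal (tangentSpace b X x) ≤ tangentSpace b X x := by
  intro u hu g hg
  have hann : ω.toDual hω.nondegenerate u ∈ (tangentSpace b X x).dualAnnihilator := by
    rw [Submodule.mem_dualAnnihilator]
    intro t ht
    rw [LinearMap.BilinForm.toDual_def]
    exact hω.alt.isRefl _ _ (hu t ht)
  rw [tangentSpace_eq_dualCoannihilator, Subspace.dualCoannihilator_dualAnnihilator_eq] at hann
  obtain ⟨f, hf, hfu⟩ := hann
  have h0 := mem_vanishingIdeal_singleton.1
    (le_vanishingIdeal_of_mem_puncturedCone hx (h g hg f hf))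
  rw [eval_poissonBracket, dualForm, LinearMap.BilinForm.apply_toDual_symm_apply] at h0
  have : (ω.toDual hω.nondegenerate).symm (differential b f x) = u :=
    (LinearEquiv.symm_apply_eq _).2 hfu
  rwa [this] at h0

end Legendrian

end Legendre

theorem mainTheorem4 {ι V : Type*} [Fintype ι] [AddCommGroup V] [Module ℂ V]
    [FiniteDimensional ℂ V] (b : Module.Basis ι ℂ V) (n : ℕ) (hn : Module.finrank ℂ V = 2 * n)
    (ω : LinearMap.BilinForm ℂ V) (hω : Legendre.IsSymplectic ω)
    (X : Set (Projectivization ℂ V)) (hX : Legendre.IsProjectiveVariety b X) :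
    Legendre.IsLegendrian b ω X ↔
      ((∀ f ∈ Legendre.idealOf b X, ∀ g ∈ Legendre.idealOf b X,
          Legendre.poissonBracket b ω hω f g ∈ Legendre.idealOf b X) ∧
        ∀ Z : Set (Projectivization ℂ V), Legendre.IsIrreducibleComponent b X Z →
          Legendre.projDim b Z = ((n - 1 : ℕ) : WithBot ℕ∞)) := by
  constructor
  · refine fun h => ⟨fun f hf g hg => h.poissonBracket_mem hω hf hg, fun Z hZ => ?_⟩
    obtain ⟨hZc, hZm⟩ := Legendre.idealOf_mem_minimalPrimes hX hZ
    rw [Legendre.projDim_eq hZ.1.2 hZc, Legendre.coneDim, h.affineDim_eq hω hn hZm]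
  · rintro ⟨hbr, hdim⟩ x hx
    have hP : ∀ P ∈ (Legendre.idealOf b X).minimalPrimes,
        Legendre.affineDim ℂ (MvPolynomial ι ℂ ⧸ P) ≤ n := by
      intro P hP
      have hZ := Legendre.isIrreducibleComponent_inter_projZeroLocus hP
      have hd := hdim _ hZ
      rw [Legendre.projDim_eq hZ.1.2 (Legendre.idealOf_mem_minimalPrimes hX hZ).1,
        Legendre.coneDim, Legendre.idealOf_inter_projZeroLocus hP] at hd
      have hd' : Legendre.affineDim ℂ (MvPolynomial ι ℂ ⧸ P) - 1 = n - 1 := by exact_mod_cast hd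
      -- a nonzero vector lies in the cone, so `n` is positive and no truncation occurs in `n - 1`
      have hn0 : 0 < n := by
        obtain ⟨hx0, -⟩ := hx.1
        have : Nontrivial V := ⟨⟨x, 0, hx0⟩⟩
        have := Module.finrank_pos (R := ℂ) (M := V)
        omega
      omega
    refine Legendre.isLagrangian_of_orthogonal_le hω hn
      (Legendre.orthogonal_tangentSpace_le hω hbr hx.1) ?_
    have h1 : Legendre.coneDimAt b X x ≤ n := Legendre.height_map_quotientMk_le
      (Legendre.le_vanishingIdeal_of_mem_puncturedCone hx.1) hP
    rw [← hx.2] at h1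
    exact_mod_cast h1
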